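/- Let $\rho$ and $\mathcal O$ be Hermitian $N\times N$ matrices, and let $J:\mathrm U(N)\to\mathbb R$, $J(U)=\operatorname{Tr}(U\rho U^\dagger\mathcal O)$, where $\mathrm U(N)\subset\mathbb C^{N\times N}$ carries the Riemannian metric induced by the real Hilbert-Schmidt inner product $\langle A,B\rangle=\operatorname{Re}\operatorname{Tr}(A^\dagger B)$. Choose $\Omega,\Gamma\in\mathrm U(N)$ with $\Omega\rho\Omega^\dagger=\operatorname{diag}(\lambda_1,\dots,\lambda_N)$ and $\Gamma\mathcal O\Gamma^\dagger=\operatorname{diag}(\sigma_1,\dots,\sigma_N)$, $\lambda_1\ge\dots\ge\lambda_N$, $\sigma_1\ge\dots\ge\sigma_N$. Let $(m_i)$ be the multiplicities of the distinct values of $\sigma$ and $(n_j)$ those of the distinct values of $\lambda$, and let $\mathrm U(\mathbf m)=\bigoplus_i\mathrm U(m_i)$ and $\mathrm U(\mathbf n)=\bigoplus_j\mathrm U(n_j)$ be the corresponding groups of block diagonal unitary matrices. For a permutation $\tau$ with permutation matrix $\mathscr P$, $\mathscr P|k\rangle=|\tau(k)\rangle$, put $C_\tau=\Gamma^\dagger\,\mathrm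 U(\mathbf m)\,\mathscr P\,\mathrm U(\mathbf n)\,\Omega$, and let $k_{ij}$ be the number of indices $l$ for which $\sigma_{\tau(l)}$ is the $i$-th distinct value of $\sigma$ and $\lambda_l$ is the $j$-th distinct value of $\lambda$. The set of critical points of $J$ is the union of the sets $C_\tau$, which are embedded submanifolds of $\mathrm U(N)$ and are called the critical submanifolds of $J$. Let $U=\Gamma^\dagger V\mathscr PW^\dagger\Omega\in C_\tau$ with $V\in\mathrm U(\mathbf m)$, $W\in\mathrm U(\mathbf n)$. For $\tilde X$ among the matrices $i|l\rangle\langle l|$ (where $j=k=l$ below), $\frac{i}{\sqrt2}(|j\rangle\langle k|+|k\rangle\langle j|)$ and $\frac1{\sqrt2}(|j\rangle\langle k|-|k\rangle\langle j|)$, $j<k$, let $X=\Gamma^\dagger V\mathscr P\tilde XW^\dagger\Omega$. Then $U^\dagger X$ commutes with $U^\dagger\mathcal OU$ if and only if $\sigma_{\tau(j)}=\sigma_{\tau(k)}$, and with $\rho$ if and only if $\lambda_j=\lambda_k$. Those $X$ for which $U^\dagger X$ commutes (1) with $U^\dagger\mathcal OU$ but not with $\rho$, (2) with $\rho$ but not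 with $U^\dagger\mathcal OU$, (3) with both, form together an orthonormal basis of $T_UC_\tau$; the three categories have $\sum_i m_i^2-\sum_{ij}k_{ij}^2$, $\sum_j n_j^2-\sum_{ij}k_{ij}^2$ and $\sum_{ij}k_{ij}^2$ elements. For tangent vectors $X,Y\in T_UC_\tau$, the second fundamental form $S(X,Y)$ of $C_\tau$ in $\mathrm U(N)$ is the component of $\nabla_X\hat Y$ normal to $C_\tau$, where $\nabla$ is the Levi-Civita connection of $\mathrm U(N)$ and $\hat Y$ is any smooth local extension of $Y$ that is tangent to $C_\tau$ along $C_\tau$. For a vector $Z\in T_U\mathrm U(N)$ normal to $C_\tau$, the shape operator $A_Z:T_UC_\tau\to T_UC_\tau$ is given by $\langle A_ZX,Y\rangle=\langle S(X,Y),Z\rangle$. For every such $Z$, the matrix of $A_Z$ in the above basis, ordered by category, has the block form $$A_Z=\begin{bmatrix}0&B&0\\B^{T}&0&0\\0&0&0\end{bmatrix}$$ for some real matrix $B$ (which depends on $Z$). Hence $\operatorname{Tr}A_Z=0$, and the mean curvature vector $H=\sum_iS(X_i,X_i)$, for any orthonormal basis $(X_i)$ of $T_UC_\tau$, vanishes;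 so every critical submanifold of $J$ is a minimal submanifold of $\mathrm U(N)$. If $\rho$ and $\mathcal O$ are both fully non-degenerate (all $\lambda_j$ are distinct and all $\sigma_j$ are distinct), then every $A_Z$ is zero and every critical submanifold is totally geodesic in $\mathrm U(N)$. If $\rho=|i\rangle\langle i|/\langle i|i\rangle$ and $\mathcal O=|f\rangle\langle f|/\langle f|f\rangle$ for non-zero vectors $|i\rangle,|f\rangle\in\mathbb C^N$, so that $J=P_{i\to f}$ is the transition probability, then the set of maximum points of $J$ on $\mathrm U(N)$ is the critical submanifold $C_\tau$ of the identity permutation, every $A_Z$ on it is zero, and it is totally geodesic in $\mathrm U(N)$. -/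

import Mathlib

open scoped ContDiff Topology

-- Matrices carry the Hilbert-Schmidt (Frobenius) norm.
attribute [local instance] Matrix.frobeniusNormedAddCommGroup

noncomputable section

namespace Landscape

/-! ### Extrinsic Riemannian geometry

Submanifolds of a Euclidean space `E`; every submanifold carries the Riemannian metric induced by
the inner product of `E`. -/

section Geometry

variable {E : Type*} [NormedAddCommGroup E] [InnerProductSpace ℝ E]

/-- `C` is a smooth embedded submanifold of `E`: around each of its points there is a smooth chart
of `E` that maps `C` onto a linear slice. -/
def IsEmbeddedSubmanifold (C : Set E) : Prop :=
  ∀ p ∈ C, ∃ (e : OpenPartialHomeomorph E E) (F : Submodule ℝ E),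
    p ∈ e.source ∧ ContDiffOn ℝ ∞ e e.source ∧ ContDiffOn ℝ ∞ e.symm e.target ∧
      ∀ q ∈ e.source, (q ∈ C ↔ e q ∈ F)

/-- The tangent space of `C` at `p`: the velocities at `p` of smooth curves in `C` through `p`
(for a submanifold these already form a linear space, so that the span adds nothing). -/
def tangentSpace (C : Set E) (p : E) : Submodule ℝ E :=
  Submodule.span ℝ {v | ∃ γ : ℝ → E, ContDiffAt ℝ ∞ γ 0 ∧ (∀ᶠ s in 𝓝 (0 : ℝ), γ s ∈ C) ∧
    γ 0 = p ∧ deriv γ 0 = v}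

/-- `Yh` is a smooth local extension, around `p`, of the vector `Y` to a vector field
that is tangent to `C` along `C`. -/
structure IsTangentExtension (C : Set E) (p Y : E) (Yh : E → E) : Prop where
  smooth : ContDiffAt ℝ ∞ Yh p
  value : Yh p = Y
  tangent : ∀ᶠ q in 𝓝[C] p, Yh q ∈ tangentSpace C q

/-- The critical points on `M` of a smooth function `f`, given on the ambient space `E`:
its differential vanishes on the tangent space of `M`. -/
def criticalPoints (M : Set E) (f : E → ℝ) : Set E :=
  {p | p ∈ M ∧ ∀ X ∈ tangentSpace M p, fderiv ℝ f p X = 0}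

variable [FiniteDimensional ℝ E]

/-- The Levi-Civita covariant derivative `∇_X Yh` at `p` of the submanifold `M` of `E`:
the ordinary derivative in `E`, projected orthogonally to the tangent space of `M`. -/
def covDeriv (M : Set E) (p X : E) (Yh : E → E) : E :=
  (tangentSpace M p).starProjection (fderiv ℝ Yh p X)

/-- `S` is the second fundamental form at `p` of `C`, as a submanifold of `M`:
`S X Y` is the component of `∇_X Yh` normal to `C`, where `Yh` is a smooth local extension of `Y`.
Extensions exist, and the value is the same for all of them; in particular `S` is unique. -/
def IsSecondFundamentalForm (M C : Set E) (p : E)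
    (S : tangentSpace C p →ₗ[ℝ] tangentSpace C p →ₗ[ℝ] E) : Prop :=
  ∀ X Y : tangentSpace C p,
    (∃ Yh : E → E, IsTangentExtension C p (Y : E) Yh) ∧
    ∀ Yh : E → E, IsTangentExtension C p (Y : E) Yh →
      S X Y = (tangentSpace C p)ᗮ.starProjection (covDeriv M p (X : E) Yh)

theorem IsSecondFundamentalForm.unique {M C : Set E} {p : E}
    {S S' : tangentSpace C p →ₗ[ℝ] tangentSpace C p →ₗ[ℝ] E}
    (h : IsSecondFundamentalForm M C p S) (h' : IsSecondFundamentalForm M C p S') : S = S' := by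
  refine LinearMap.ext fun X => LinearMap.ext fun Y => ?_
  obtain ⟨Yh, hY⟩ := (h X Y).1
  rw [(h X Y).2 Yh hY, (h' X Y).2 Yh hY]

/-- The normal space at `p` of `C`, as a submanifold of `M`. -/
def normalSpace (M C : Set E) (p : E) : Submodule ℝ E :=
  tangentSpace M p ⊓ (tangentSpace C p)ᗮ

/-- `A` is the shape operator (Weingarten map) `A_Z` at `p` of `C`, as a submanifold of `M`:
`⟨A_Z X, Y⟩ = ⟨S(X, Y), Z⟩`. -/
def IsShapeOperator (M C : Set E) (p Z : E)
    (A : tangentSpace C p →ₗ[ℝ] tangentSpace C p) : Prop :=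
  ∃ S, IsSecondFundamentalForm M C p S ∧
    ∀ X Y : tangentSpace C p, inner ℝ (A X) Y = inner ℝ (S X Y) Z

/-- `C` is a minimal submanifold of `M`: its mean curvature vector `∑ S(X_i, X_i)`,
for any orthonormal basis `X_i` of the tangent space, vanishes at every point. -/
def IsMinimalSubmanifold (M C : Set E) : Prop :=
  C ⊆ M ∧ IsEmbeddedSubmanifold C ∧
    ∀ p ∈ C, ∃ S, IsSecondFundamentalForm M C p S ∧
      ∀ (d : ℕ) (b : OrthonormalBasis (Fin d) ℝ (tangentSpace C p)), ∑ i, S (b i) (b i) = 0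

/-- `γ` is a geodesic of `M` on the open set `I` of parameters: a smooth curve in `M` whose
velocity field is parallel, that is, whose acceleration in `E` is normal to `M`. -/
def IsGeodesicOn (M : Set E) (γ : ℝ → E) (I : Set ℝ) : Prop :=
  ContDiffOn ℝ ∞ γ I ∧ ∀ s ∈ I, γ s ∈ M ∧
    (tangentSpace M (γ s)).starProjection (deriv (deriv γ) s) = 0

/-- `C` is a totally geodesic submanifold of `M`: every geodesic of `M` that starts at a point
of `C`, in a direction tangent to `C`, stays in `C` for small times. -/
def IsTotallyGeodesic (M C : Set E) : Prop :=
  C ⊆ M ∧ IsEmbeddedSubmanifold C ∧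
    ∀ (γ : ℝ → E) (ε : ℝ), 0 < ε → IsGeodesicOn M γ (Set.Ioo (-ε) ε) →
      γ 0 ∈ C → deriv γ 0 ∈ tangentSpace C (γ 0) → ∀ᶠ s in 𝓝 (0 : ℝ), γ s ∈ C

end Geometry

/-! ### Matrices with the real Hilbert-Schmidt inner product -/

/-- Complex `N × N` matrices. -/
abbrev Mat (N : ℕ) : Type := Matrix (Fin N) (Fin N) ℂ

/-- The real Hilbert-Schmidt inner product `⟨A, B⟩ = Re Tr(A† B)`. -/
instance instInnerProductSpaceMat (N : ℕ) : InnerProductSpace ℝ (Mat N) where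
  toNormedSpace := Matrix.frobeniusNormedSpace
  inner A B := (Matrix.trace (A.conjTranspose * B)).re
  norm_sq_eq_re_inner A := by
    have h : ‖A‖ ^ 2 = ∑ i, ∑ j, ‖A i j‖ ^ 2 := by
      have h0 : (0 : ℝ) ≤ ∑ i, ∑ j, ‖A i j‖ ^ (2 : ℝ) := by positivity
      have h1 := Matrix.frobenius_norm_def A
      rw [← Real.sqrt_eq_rpow] at h1
      rw [h1, Real.sq_sqrt h0]
      simp
    rw [h, Finset.sum_comm]
    simp only [RCLike.re_to_real, Matrix.trace, Matrix.diag_apply, Matrix.mul_apply,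
      Matrix.conjTranspose_apply, Complex.re_sum]
    refine Finset.sum_congr rfl fun i _ => Finset.sum_congr rfl fun j _ => ?_
    rw [← Complex.normSq_eq_norm_sq, Complex.normSq_apply]
    simp
  conj_inner_symm A B := by
    have h : Matrix.trace (B.conjTranspose * A)
        = star (Matrix.trace (A.conjTranspose * B)) := by
      rw [← Matrix.trace_conjTranspose, Matrix.conjTranspose_mul,
        Matrix.conjTranspose_conjTranspose]
    simp [h]
  add_left A B C := by simp [Matrix.add_mul]
  smul_left A B r := by simp

/-! ### The landscape and its critical submanifolds -/

variable {N : ℕ}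

/-- The unitary group `U(N)`, as a subset of the space of matrices. -/
def unitarySet (N : ℕ) : Set (Mat N) := {U | U ∈ Matrix.unitaryGroup (Fin N) ℂ}

/-- The landscape `J(U) = Tr(U ρ U† O)`, which is real for Hermitian `ρ` and `O`. -/
def landscape (ρ O : Mat N) (U : Mat N) : ℝ :=
  (Matrix.trace (U * ρ * U.conjTranspose * O)).re

/-- The critical points of the landscape on `U(N)`. -/
def criticalSet (ρ O : Mat N) : Set (Mat N) :=
  criticalPoints (unitarySet N) (landscape ρ O)

/-- The points of `U(N)` at which the landscape attains its maximum on `U(N)`. -/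
def maximumSet (ρ O : Mat N) : Set (Mat N) :=
  {U | U ∈ unitarySet N ∧ ∀ V ∈ unitarySet N, landscape ρ O V ≤ landscape ρ O U}

/-- The unitary matrices that are block diagonal with respect to the level sets of `a`.
If `a` is non-increasing with multiplicities `a₁, …, a_b`,
this is `U(a₁) ⊕ ⋯ ⊕ U(a_b)`. -/
def blockUnitary (a : Fin N → ℝ) : Set (Mat N) :=
  {V | V ∈ unitarySet N ∧ ∀ j k, a j ≠ a k → V j k = 0}

/-- The permutation matrix with `P |k⟩ = |τ k⟩`. -/
def permMat (τ : Equiv.Perm (Fin N)) : Mat N :=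
  Matrix.of fun j k => if j = τ k then 1 else 0

/-- The point `Γ† V P W† Ω`. -/
def orbitPoint (Γ Ω : Mat N) (τ : Equiv.Perm (Fin N)) (V W : Mat N) : Mat N :=
  Γ.conjTranspose * V * permMat τ * W.conjTranspose * Ω

/-- The critical submanifold `Γ† U(m) P U(n) Ω`, where `sig` and `lam` list the eigenvalues of
the observable and of the density matrix. -/
def criticalSubmanifold (sig lam : Fin N → ℝ) (Γ Ω : Mat N) (τ : Equiv.Perm (Fin N)) :
    Set (Mat N) :=
  {U | ∃ V ∈ blockUnitary sig, ∃ W ∈ blockUnitary lam, U = orbitPoint Γ Ω τ V W}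

/-! ### The natural basis of tangent vectors -/

/-- The natural orthonormal basis of the skew-Hermitian matrices: `i|l⟩⟨l|`, and for `j < k`
`(i/√2)(|j⟩⟨k| + |k⟩⟨j|)` (with index `(j, k)`) and `(1/√2)(|j⟩⟨k| - |k⟩⟨j|)`
(with index `(k, j)`). -/
def skewBasis (e : Fin N × Fin N) : Mat N :=
  if e.1 = e.2 then Matrix.single e.1 e.1 Complex.I
  else if e.1 < e.2 then
    (Complex.I / (Real.sqrt 2 : ℂ)) • (Matrix.single e.1 e.2 (1 : ℂ) + Matrix.single e.2 e.1 1)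
  else
    (1 / (Real.sqrt 2 : ℂ)) • (Matrix.single e.2 e.1 (1 : ℂ) - Matrix.single e.1 e.2 1)

/-- The vector `X = Γ† V P X̃ W† Ω` at the point `Γ† V P W† Ω`, for `X̃` in `skewBasis`. -/
def naturalVector (Γ Ω : Mat N) (τ : Equiv.Perm (Fin N)) (V W : Mat N) (e : Fin N × Fin N) :
    Mat N :=
  Γ.conjTranspose * V * permMat τ * skewBasis e * W.conjTranspose * Ω

/-- First category: `U†X` commutes with `U†OU` but not with `ρ`. -/
abbrev Cat1 (sig lam : Fin N → ℝ) (τ : Equiv.Perm (Fin N)) : Type :=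
  {e : Fin N × Fin N // sig (τ e.1) = sig (τ e.2) ∧ lam e.1 ≠ lam e.2}

/-- Second category: `U†X` commutes with `ρ` but not with `U†OU`. -/
abbrev Cat2 (sig lam : Fin N → ℝ) (τ : Equiv.Perm (Fin N)) : Type :=
  {e : Fin N × Fin N // sig (τ e.1) ≠ sig (τ e.2) ∧ lam e.1 = lam e.2}

/-- Third category: `U†X` commutes with both `U†OU` and `ρ`. -/
abbrev Cat3 (sig lam : Fin N → ℝ) (τ : Equiv.Perm (Fin N)) : Type :=
  {e : Fin N × Fin N // sig (τ e.1) = sig (τ e.2) ∧ lam e.1 = lam e.2}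

/-- The index in `Fin N × Fin N` of a tangent basis vector. -/
def catIndex (sig lam : Fin N → ℝ) (τ : Equiv.Perm (Fin N)) :
    (Cat1 sig lam τ ⊕ Cat2 sig lam τ) ⊕ Cat3 sig lam τ → Fin N × Fin N :=
  Sum.elim (Sum.elim Subtype.val Subtype.val) Subtype.val

/-- `∑ aᵢ²`, over the multiplicities `aᵢ` of the distinct values of `a`. -/
def sumSqMult (a : Fin N → ℝ) : ℕ :=
  ∑ x ∈ Finset.univ.image a, (Finset.univ.filter fun j => a j = x).card ^ 2

/-- `∑ k_{ij}²`, over the entries of the contingency table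
`k_{ij} = #{l | sig (τ l) = i-th value, lam l = j-th value}`. -/
def sumSqContingency (sig lam : Fin N → ℝ) (τ : Equiv.Perm (Fin N)) : ℕ :=
  ∑ x ∈ Finset.univ.image sig, ∑ y ∈ Finset.univ.image lam,
    (Finset.univ.filter fun l => sig (τ l) = x ∧ lam l = y).card ^ 2

/-- The orthogonal projection `|v⟩⟨v| / ⟨v|v⟩` onto the line spanned by a non-zero vector `v`. -/
def rankOneProj (v : Fin N → ℂ) : Mat N :=
  (dotProduct (star v) v)⁻¹ • Matrix.vecMulVec v (star v)

end Landscape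

end

noncomputable section

namespace Landscape

/-! ### Tangent spaces, slice charts and second fundamental forms in a Euclidean space. -/

section Geometry

variable {E : Type*} [NormedAddCommGroup E] [InnerProductSpace ℝ E]

/-! Moving the permutation matrix past `U(m)` writes every critical submanifold as `g U(a) U(b) h`,
with `a = sig ∘ τ`, `b = lam` and `g`, `h` unitary (`criticalSubmanifold_eq_orbit`). Block unitaries
can be absorbed into `g` and `h`, so it is enough to work at the point `g h`. There `x ↦ g x h` is
an isometry that identifies tangent vectors with the skew-Hermitian matrices supported on the blocks
of `a` or of `b`, and normal vectors with those supported off both (`mem_tangentSpace_orbit`,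
`mem_normalModel`).

A tangent `x` splits as `L x + R x`, with `L x` in the Lie algebra of `U(a)` and `R x` in that of
`U(b)`. Transporting tangent vectors by `exp (L x)` from the left and `exp (R x)` from the right
gives a moving frame, from which the second fundamental form is the normal part of `L x * y + y * R
x` (`isSecondFundamentalForm_orbit`). If `x` and `y` both commute with `diag a`, so does their
product, which is therefore orthogonal to every normal `z`; likewise for `b`. Categories 1 and 3
commute with `diag a`, categories 2 and 3 with `diag b`, so only the pairing of 1 with 2 survives
(`shapeForm_skewBasis_eq_zero`). A basis vector paired with itself always gives zero, hence
minimality. If `a` and `b` have the same level sets, all tangent vectors commute with `diag a`, the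
form vanishes, and the geodesics `g exp(s x) h` stay in the set.

The gradient of the landscape is governed by the commutator of `U ρ U†` with `O`, so criticality
means that the two commute. Diagonalising `U ρ U†` inside the eigenspaces of `O` and comparing
spectra produces the permutation (`criticalSet_eq`). For rank-one projections the landscape is `|Q z
z|²` with `Q = Γ U Ω†`, and this equals its maximum 1 exactly when `Q` is block diagonal
(`maximumSet_eq`). -/

theorem deriv_mem_tangentSpace {C : Set E} {p v : E} {γ : ℝ → E} (hγ : ContDiffAt ℝ ∞ γ 0)
    (hC : ∀ᶠ s in 𝓝 (0 : ℝ), γ s ∈ C) (h0 : γ 0 = p) (hv : HasDerivAt γ v 0) :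
    v ∈ tangentSpace C p :=
  Submodule.subset_span ⟨γ, hγ, hC, h0, hv.deriv⟩

/-- A linear condition satisfied by the velocities of all smooth curves in `C` holds on the
tangent space. -/
theorem tangentSpace_le {C : Set E} {p : E} {T : Submodule ℝ E}
    (h : ∀ (γ : ℝ → E) (v : E), HasDerivAt γ v 0 → (∀ᶠ s in 𝓝 (0 : ℝ), γ s ∈ C) → γ 0 = p →
      v ∈ T) :
    tangentSpace C p ≤ T := by
  refine Submodule.span_le.2 ?_
  rintro v ⟨γ, hγ, hC, h0, rfl⟩
  exact h γ _ (hγ.differentiableAt (by simp)).hasDerivAt hC h0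

theorem tangentSpace_mono {C M : Set E} (h : C ⊆ M) (p : E) :
    tangentSpace C p ≤ tangentSpace M p := by
  refine Submodule.span_mono ?_
  rintro v ⟨γ, hγ, hC, h0, hv⟩
  exact ⟨γ, hγ, hC.mono fun s hs => h hs, h0, hv⟩

theorem hasDerivAt_add_smul (c v : E) : HasDerivAt (fun s : ℝ => c + s • v) v 0 := by
  simpa using ((hasDerivAt_id (0 : ℝ)).smul_const v).const_add c

theorem hasDerivAt_comp_add_smul {G : Type*} [NormedAddCommGroup G] [NormedSpace ℝ G]
    {f : E → G} {f' : E →L[ℝ] G} {c : E} (hf : HasFDerivAt f f' c) (v : E) :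
    HasDerivAt (fun s : ℝ => f (c + s • v)) (f' v) 0 :=
  HasFDerivAt.comp_hasDerivAt 0 (by simpa using hf) (hasDerivAt_add_smul c v)

variable [FiniteDimensional ℝ E]

/-- The derivative of a curve in a linear subspace lies in the subspace. -/
theorem hasDerivAt_mem_of_eventually_mem {F : Submodule ℝ E} {f : ℝ → E} {v : E} {t : ℝ}
    (hf : HasDerivAt f v t) (hF : ∀ᶠ s in 𝓝 t, f s ∈ F) : v ∈ F := by
  have h1 : HasDerivAt (fun s => Fᗮ.starProjection (f s)) (Fᗮ.starProjection v) t :=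
    (Fᗮ.starProjection).hasFDerivAt.comp_hasDerivAt t hf
  have h2 : (fun s => Fᗮ.starProjection (f s)) =ᶠ[𝓝 t] fun _ => 0 :=
    hF.mono fun s hs => Submodule.starProjection_orthogonal_apply_eq_zero hs
  have h3 : Fᗮ.starProjection v = 0 :=
    h1.unique ((hasDerivAt_const t (0 : E)).congr_of_eventuallyEq h2)
  rw [Submodule.starProjection_apply_eq_zero_iff, Submodule.orthogonal_orthogonal] at h3
  exact h3

/-- A smooth parametrisation with invertible derivative at `0` that straightens `C` gives
a slice chart. -/
theorem exists_slice_chart {C : Set E} {ψ : E → E} {ψ' : E ≃L[ℝ] E} {F : Submodule ℝ E}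
    (hψ : ContDiff ℝ ∞ ψ) (h' : HasFDerivAt ψ (ψ' : E →L[ℝ] E) 0)
    (hC : ∀ᶠ x in 𝓝 (0 : E), (ψ x ∈ C ↔ x ∈ F)) :
    ∃ e : OpenPartialHomeomorph E E, ψ 0 ∈ e.source ∧ ContDiffOn ℝ ∞ e e.source ∧
      ContDiffOn ℝ ∞ e.symm e.target ∧ (∀ q ∈ e.source, (q ∈ C ↔ e q ∈ F)) ∧
      (∀ q ∈ e.source, ψ (e q) = q) ∧ e (ψ 0) = 0 ∧
      HasFDerivAt e (ψ'.symm : E →L[ℝ] E) (ψ 0) := by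
  obtain ⟨s, hs, hso, h0s⟩ := eventually_nhds_iff.1 hC
  -- Restricting to the open set where the derivative of `ψ` is invertible makes the inverse smooth
  -- on the whole chart domain, not only at the base point.
  set R : Set E := fderiv ℝ ψ ⁻¹' Set.range ((↑) : (E ≃L[ℝ] E) → E →L[ℝ] E) with hR
  have hRo : IsOpen R := (ContinuousLinearEquiv.isOpen).preimage
    (hψ.continuous_fderiv (by simp))
  set e0 := (hψ.contDiffAt (x := 0)).toOpenPartialHomeomorph ψ h' (by simp) with he0
  have he0c : ⇑e0 = ψ := rfl
  set e1 := e0.restrOpen (s ∩ R) (hso.inter hRo) with he1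
  have he1c : ⇑e1 = ψ := rfl
  have hsrc : e1.source = e0.source ∩ (s ∩ R) := rfl
  have h01 : (0 : E) ∈ e1.source := by
    rw [hsrc]
    refine ⟨(hψ.contDiffAt (x := 0)).mem_toOpenPartialHomeomorph_source h' (by simp), h0s, ?_⟩
    exact ⟨ψ', h'.fderiv.symm⟩
  have hsymm : ∀ q ∈ e1.target, ∃ D : E ≃L[ℝ] E, HasFDerivAt ψ (D : E →L[ℝ] E) (e1.symm q) := by
    intro q hq
    have h1 := e1.map_target hq
    rw [hsrc] at h1
    obtain ⟨D, hD⟩ := h1.2.2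
    refine ⟨D, ?_⟩
    rw [hD]
    exact (hψ.differentiable (by simp) _).hasFDerivAt
  refine ⟨e1.symm, ?_, ?_, ?_, ?_, ?_, ?_, ?_⟩
  · simpa [he1c] using e1.map_source h01
  · intro q hq
    obtain ⟨D, hD⟩ := hsymm q hq
    exact (e1.contDiffAt_symm (f₀' := D) hq hD hψ.contDiffAt).contDiffWithinAt
  · simpa [he1c] using hψ.contDiffOn
  · intro q hq
    have h1 := e1.map_target hq
    rw [hsrc] at h1
    rw [← hs _ h1.2.1, ← he1c, e1.right_inv hq]
  · intro q hq
    rw [← he1c]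
    exact e1.right_inv hq
  · rw [← he1c]
    exact e1.left_inv h01
  · rw [← he1c]
    refine e1.hasFDerivAt_symm (e1.map_source h01) ?_
    rw [e1.left_inv h01]
    exact h'

/-- If the derivative of `f` at `p` is injective on the subspace `R`, then `p` is isolated among
the points of `p + R` with the same value of `f`. -/
theorem eventually_eq_zero_of_ker_inf_eq_bot {G : Type*} [NormedAddCommGroup G] [NormedSpace ℝ G]
    {f : E → G} {f' : E →L[ℝ] G} {p : E} {R : Submodule ℝ E} (hf : HasFDerivAt f f' p)
    (hR : ∀ v ∈ R, f' v = 0 → v = 0) :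
    ∀ᶠ v in 𝓝 (0 : E), v ∈ R → f (p + v) = f p → v = 0 := by
  have hd : HasFDerivAt (fun v : R => f (p + v)) (f'.comp R.subtypeL) 0 := by
    have h1 : HasFDerivAt (fun v : R => p + (v : E)) R.subtypeL 0 :=
      (R.subtypeL.hasFDerivAt).const_add p
    exact HasFDerivAt.comp (0 : R) (by simpa using hf) h1
  have hker : (f'.comp R.subtypeL).toLinearMap.ker = ⊥ := by
    rw [LinearMap.ker_eq_bot']
    intro v hv
    exact Subtype.ext (hR v v.2 hv)
  -- An injective linear map on a finite-dimensional space is bounded below; this keeps nearby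
  -- values of `f` away from `f p`.
  obtain ⟨K, -, hK⟩ := LinearMap.exists_antilipschitzWith _ hker
  have hev := hd.eventually_ne (c := f p) ⟨K, hK⟩
  rw [eventually_nhdsWithin_iff, Metric.eventually_nhds_iff] at hev
  obtain ⟨ε, hε, h⟩ := hev
  rw [Metric.eventually_nhds_iff]
  refine ⟨ε, hε, fun v hv hvR hfv => ?_⟩
  by_contra hne
  refine h (y := ⟨v, hvR⟩) (by simpa [dist_eq_norm] using hv) ?_ hfv
  simpa [Subtype.ext_iff] using hne

/-- The bilinear map `(X, Y) ↦ D X Y`, projected to the tangent space of `M`,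
then to the normal space of `C`. -/
def normalPart (M C : Set E) (p : E) (D : E →ₗ[ℝ] E →ₗ[ℝ] E) :
    tangentSpace C p →ₗ[ℝ] tangentSpace C p →ₗ[ℝ] E :=
  ((D.compl₁₂ (tangentSpace C p).subtype (tangentSpace C p).subtype).compr₂
    (tangentSpace M p).starProjection.toLinearMap).compr₂
    (tangentSpace C p)ᗮ.starProjection.toLinearMap

theorem normalPart_apply (M C : Set E) (p : E) (D : E →ₗ[ℝ] E →ₗ[ℝ] E)
    (X Y : tangentSpace C p) :
    normalPart M C p D X Y =
      (tangentSpace C p)ᗮ.starProjection ((tangentSpace M p).starProjection (D X Y)) := rfl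

/-- The second fundamental form, from a moving frame: `Φ q` maps the tangent space at `p` into
that at `q`, `Ψ q` maps it back, and `-D` is the derivative of `Ψ` at `p`. -/
theorem isSecondFundamentalForm_normalPart {M C : Set E} (hCM : C ⊆ M) {p : E}
    {D : E →ₗ[ℝ] E →ₗ[ℝ] E}
    {Φ Ψ : E → E → E} (hΦ : ∀ Y, ContDiffAt ℝ ∞ (fun q => Φ q Y) p) (hΦp : ∀ Y, Φ p Y = Y)
    (hΦT : ∀ᶠ q in 𝓝[C] p, ∀ Y ∈ tangentSpace C p, Φ q Y ∈ tangentSpace C q)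
    (hΨ : ∀ (γ y : ℝ → E) (v y' : E), γ 0 = p → HasDerivAt γ v 0 → HasDerivAt y y' 0 →
      HasDerivAt (fun s => Ψ (γ s) (y s)) (y' - D v (y 0)) 0)
    (hΨT : ∀ᶠ q in 𝓝[C] p, ∀ W ∈ tangentSpace C q, Ψ q W ∈ tangentSpace C p) :
    IsSecondFundamentalForm M C p (normalPart M C p D) := by
  set P := tangentSpace C p
  intro X Y
  refine ⟨⟨fun q => Φ q Y, hΦ _, hΦp _, hΦT.mono fun q hq => hq _ Y.2⟩, fun Yh hY => ?_⟩
  have hd : HasFDerivAt Yh (fderiv ℝ Yh p) p := (hY.smooth.differentiableAt (by simp)).hasFDerivAt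
  -- Along a curve in `C`, pulling the field back by `Ψ` gives a curve in the fixed subspace `P`, so
  -- its derivative lies in `P`. The ambient derivative of any extension thus differs from `D X Y`
  -- by a tangent vector, which the normal projection kills.
  have key : ∀ X ∈ P, fderiv ℝ Yh p X - D X Y ∈ P := by
    let T : Submodule ℝ E := P.comap ((fderiv ℝ Yh p).toLinearMap - D.flip Y)
    suffices h : P ≤ T from fun X hX => h hX
    refine tangentSpace_le fun γ v hγ hC h0 => ?_
    have hy : HasDerivAt (fun s => Yh (γ s)) (fderiv ℝ Yh p v) 0 :=
      HasFDerivAt.comp_hasDerivAt 0 (by rw [h0]; exact hd) hγ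
    have h1 := hΨ γ _ v _ h0 hγ hy
    have h2 : ∀ᶠ s in 𝓝 (0 : ℝ), Ψ (γ s) (Yh (γ s)) ∈ P := by
      have ht : Filter.Tendsto γ (𝓝 0) (𝓝[C] p) :=
        tendsto_nhdsWithin_iff.2 ⟨h0 ▸ hγ.continuousAt.tendsto, hC⟩
      exact ((ht.eventually hΨT).and (ht.eventually hY.tangent)).mono fun s hs => hs.1 _ hs.2
    have h3 := hasDerivAt_mem_of_eventually_mem h1 h2
    simp only [h0, hY.value] at h3
    change fderiv ℝ Yh p v - D v Y ∈ P
    exact h3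
  have h1 := key X X.2
  rw [normalPart_apply, covDeriv]
  have h2 : (tangentSpace M p).starProjection (fderiv ℝ Yh p X - D X Y) =
      fderiv ℝ Yh p X - D X Y :=
    Submodule.starProjection_eq_self_iff.2 (tangentSpace_mono hCM p h1)
  rw [← sub_eq_zero, ← map_sub, ← map_sub, ← neg_sub (fderiv ℝ Yh p X) (D X Y), map_neg, h2, map_neg,
    neg_eq_zero]
  exact Submodule.starProjection_orthogonal_apply_eq_zero h1

/-- On normal vectors, both projections in `normalPart` may be dropped. -/
theorem inner_normalPart {M C : Set E} {p Z : E} (hZ : Z ∈ normalSpace M C p)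
    (D : E →ₗ[ℝ] E →ₗ[ℝ] E) (X Y : tangentSpace C p) :
    inner ℝ (normalPart M C p D X Y) Z = inner ℝ (D X Y) Z := by
  rw [normalPart_apply, Submodule.inner_starProjection_left_eq_right,
    Submodule.starProjection_eq_self_iff.2 hZ.2, Submodule.inner_starProjection_left_eq_right,
    Submodule.starProjection_eq_self_iff.2 hZ.1]

/-- Allows the mean curvature vector itself to be used as the normal vector `Z` against which it is
tested. -/
theorem normalPart_mem {M C : Set E} (hCM : C ⊆ M) {p : E}
    (D : E →ₗ[ℝ] E →ₗ[ℝ] E) (X Y : tangentSpace C p) :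
    normalPart M C p D X Y ∈ normalSpace M C p := by
  refine ⟨?_, Submodule.starProjection_apply_mem _ _⟩
  rw [normalPart_apply]
  set v := (tangentSpace M p).starProjection (D X Y)
  have hv : v ∈ tangentSpace M p := Submodule.starProjection_apply_mem _ _
  have h : (tangentSpace C p)ᗮ.starProjection v = v - (tangentSpace C p).starProjection v := by
    rw [Submodule.starProjection_orthogonal_val]
  rw [h]
  exact Submodule.sub_mem _ hv
    (tangentSpace_mono hCM p (Submodule.starProjection_apply_mem _ _))

/-- A bilinear form has a representing operator. -/
theorem exists_inner_eq_bilinear {T : Submodule ℝ E} (S : T →ₗ[ℝ] T →ₗ[ℝ] E) (Z : E) :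
    ∃ A : T →ₗ[ℝ] T, ∀ X Y : T, inner ℝ (A X) Y = inner ℝ (S X Y) Z := by
  let b := stdOrthonormalBasis ℝ T
  refine ⟨∑ i, ((innerₗ E Z).comp (S.flip (b i))).smulRight (b i), fun X Y => ?_⟩
  have hY : Y = ∑ i, inner ℝ (b i) Y • b i := (b.sum_repr' Y).symm
  conv_rhs => rw [hY]
  simp only [LinearMap.sum_apply, LinearMap.smulRight_apply, sum_inner, inner_smul_left,
    map_sum, map_smul]
  refine Finset.sum_congr rfl fun i _ => ?_
  simp [real_inner_comm, mul_comm]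

/-- The trace of a vector-valued bilinear form does not depend on the orthonormal basis. -/
theorem sum_bilinear_orthonormalBasis {T : Submodule ℝ E} (S : T →ₗ[ℝ] T →ₗ[ℝ] E)
    {ι κ : Type*} [Fintype ι] [Fintype κ] (b : OrthonormalBasis ι ℝ T)
    (c : OrthonormalBasis κ ℝ T) : ∑ i, S (b i) (b i) = ∑ i, S (c i) (c i) := by
  refine ext_inner_right ℝ fun Z => ?_
  -- Tested against a fixed `Z`, both sums become the trace of one operator.
  obtain ⟨A, hA⟩ := exists_inner_eq_bilinear S Z
  simp only [sum_inner, ← hA]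
  rw [Finset.sum_congr rfl fun i _ => real_inner_comm (b i) (A (b i)),
    Finset.sum_congr rfl fun i _ => real_inner_comm (c i) (A (c i)),
    ← LinearMap.trace_eq_sum_inner A b, ← LinearMap.trace_eq_sum_inner A c]

end Geometry

open Matrix

variable {N : ℕ}

/-! ### Unitary and block diagonal matrices -/

/-- The real diagonal matrix with entries `a`. -/
abbrev realDiag (a : Fin N → ℝ) : Mat N := diagonal fun j => (a j : ℂ)

theorem realDiag_apply (a : Fin N → ℝ) (j k : Fin N) :
    realDiag a j k = if j = k then (a j : ℂ) else 0 := diagonal_apply ..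

theorem conjTranspose_realDiag (a : Fin N → ℝ) : (realDiag a)ᴴ = realDiag a := by
  rw [diagonal_conjTranspose]
  congr 1
  funext j
  simp

theorem commute_realDiag (a b : Fin N → ℝ) : Commute (realDiag a) (realDiag b) := by
  rw [commute_iff_eq, diagonal_mul_diagonal, diagonal_mul_diagonal]
  simp only [mul_comm]

/-- The commutator with `diag a` has entries `(a k - a j) K j k`. Support conditions on blocks
thereby become commutation relations, which are stable under products and exponentials. -/
theorem commute_realDiag_iff {a : Fin N → ℝ} {K : Mat N} :
    Commute K (realDiag a) ↔ ∀ j k, a j ≠ a k → K j k = 0 := by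
  rw [commute_iff_eq, ← Matrix.ext_iff]
  refine forall_congr' fun j => forall_congr' fun k => ?_
  rw [mul_diagonal, diagonal_mul, mul_comm, ← sub_eq_zero, ← sub_mul, mul_eq_zero, sub_eq_zero,
    Complex.ofReal_inj, or_iff_not_imp_left]
  exact ⟨fun h hjk => h (Ne.symm hjk), fun h hjk => h (Ne.symm hjk)⟩

theorem conjTranspose_mul_self {U : Mat N} (h : U ∈ unitarySet N) : Uᴴ * U = 1 :=
  mem_unitaryGroup_iff'.1 h

theorem mul_conjTranspose_self {U : Mat N} (h : U ∈ unitarySet N) : U * Uᴴ = 1 :=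
  mem_unitaryGroup_iff.1 h

theorem conjTranspose_mul_cancel {U : Mat N} (h : U ∈ unitarySet N) (X : Mat N) :
    Uᴴ * (U * X) = X := by rw [← mul_assoc, conjTranspose_mul_self h, one_mul]

theorem mul_conjTranspose_cancel {U : Mat N} (h : U ∈ unitarySet N) (X : Mat N) :
    U * (Uᴴ * X) = X := by rw [← mul_assoc, mul_conjTranspose_self h, one_mul]

theorem one_mem_unitarySet : (1 : Mat N) ∈ unitarySet N := one_mem (unitaryGroup (Fin N) ℂ)

theorem mul_mem_unitarySet {U V : Mat N} (hU : U ∈ unitarySet N) (hV : V ∈ unitarySet N) :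
    U * V ∈ unitarySet N := (unitaryGroup (Fin N) ℂ).mul_mem hU hV

theorem conjTranspose_mem_unitarySet {U : Mat N} (hU : U ∈ unitarySet N) :
    Uᴴ ∈ unitarySet N := Unitary.star_mem hU

theorem mem_blockUnitary_iff {a : Fin N → ℝ} {V : Mat N} :
    V ∈ blockUnitary a ↔ V ∈ unitarySet N ∧ Commute V (realDiag a) :=
  and_congr_right fun _ => commute_realDiag_iff.symm

theorem one_mem_blockUnitary (a : Fin N → ℝ) : (1 : Mat N) ∈ blockUnitary a :=
  mem_blockUnitary_iff.2 ⟨one_mem_unitarySet, Commute.one_left _⟩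

theorem mul_mem_blockUnitary {a : Fin N → ℝ} {U V : Mat N} (hU : U ∈ blockUnitary a)
    (hV : V ∈ blockUnitary a) : U * V ∈ blockUnitary a := by
  rw [mem_blockUnitary_iff] at *
  exact ⟨mul_mem_unitarySet hU.1 hV.1, hU.2.mul_left hV.2⟩

theorem conjTranspose_mem_blockUnitary {a : Fin N → ℝ} {U : Mat N} (hU : U ∈ blockUnitary a) :
    Uᴴ ∈ blockUnitary a := by
  refine ⟨conjTranspose_mem_unitarySet hU.1, fun j k h => ?_⟩
  rw [conjTranspose_apply, hU.2 k j (Ne.symm h), star_zero]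

/-- Conjugating a diagonal matrix by `u v`, for block diagonal `u` and `v`. -/
theorem commute_conj_of_mem_blockUnitary {a b : Fin N → ℝ} {u v : Mat N}
    (hu : u ∈ blockUnitary a) (hv : v ∈ blockUnitary b) :
    Commute (u * v * realDiag b * (u * v)ᴴ) (realDiag a) := by
  have hv2 : v * realDiag b * vᴴ = realDiag b := by
    rw [(mem_blockUnitary_iff.1 hv).2.eq, mul_assoc, mul_conjTranspose_self hv.1, mul_one]
  have h : u * v * realDiag b * (u * v)ᴴ = u * realDiag b * uᴴ := by
    rw [conjTranspose_mul]
    conv_rhs => rw [← hv2]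
    simp only [mul_assoc]
  rw [h]
  exact ((mem_blockUnitary_iff.1 hu).2.mul_left (commute_realDiag b a)).mul_left
    (mem_blockUnitary_iff.1 (conjTranspose_mem_blockUnitary hu)).2

/-! ### Skew-Hermitian matrices and the exponential -/

/-- The skew-Hermitian matrices. -/
def skewModel (N : ℕ) : Submodule ℝ (Mat N) where
  carrier := {K | Kᴴ = -K}
  add_mem' {A B} hA hB := by
    simp only [Set.mem_ofPred_eq] at *
    rw [conjTranspose_add, hA, hB, neg_add]
  zero_mem' := by simp
  smul_mem' r A hA := by
    simp only [Set.mem_ofPred_eq] at *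
    rw [conjTranspose_smul, hA, smul_neg, star_trivial]

theorem mem_skewModel {K : Mat N} : K ∈ skewModel N ↔ Kᴴ = -K := Iff.rfl

/-- The model of the tangent spaces of the critical submanifolds: skew-Hermitian matrices whose
entries vanish where both `a` and `b` take different values. -/
def tangentModel (a b : Fin N → ℝ) : Submodule ℝ (Mat N) where
  carrier := {K | Kᴴ = -K ∧ ∀ j k, a j ≠ a k → b j ≠ b k → K j k = 0}
  add_mem' {A B} hA hB :=
    ⟨(skewModel N).add_mem hA.1 hB.1, fun j k h h' => by
      rw [Matrix.add_apply, hA.2 j k h h', hB.2 j k h h', add_zero]⟩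
  zero_mem' := ⟨by simp, fun _ _ _ _ => rfl⟩
  smul_mem' r A hA :=
    ⟨(skewModel N).smul_mem r hA.1, fun j k h h' => by
      rw [Matrix.smul_apply, hA.2 j k h h', smul_zero]⟩

/-- The skew-Hermitian part of the blocks of `a`. -/
def leftPart (a : Fin N → ℝ) : Mat N →ₗ[ℝ] Mat N where
  toFun X := of fun j k => if a j = a k then (X j k - star (X k j)) / 2 else 0
  map_add' X Y := by
    ext j k
    simp only [of_apply, Matrix.add_apply, star_add]
    split_ifs <;> ring
  map_smul' r X := by
    ext j k
    simp only [of_apply, Matrix.smul_apply, Complex.real_smul, star_mul', RingHom.id_apply,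
      Complex.star_def, Complex.conj_ofReal]
    split_ifs <;> ring

/-- The skew-Hermitian part of the entries in the blocks of `b`, but not in those of `a`. -/
def rightPart (a b : Fin N → ℝ) : Mat N →ₗ[ℝ] Mat N where
  toFun X := of fun j k => if a j ≠ a k ∧ b j = b k then (X j k - star (X k j)) / 2 else 0
  map_add' X Y := by
    ext j k
    simp only [of_apply, Matrix.add_apply, star_add]
    split_ifs <;> ring
  map_smul' r X := by
    ext j k
    simp only [of_apply, Matrix.smul_apply, Complex.real_smul, star_mul', RingHom.id_apply,
      Complex.star_def, Complex.conj_ofReal]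
    split_ifs <;> ring

theorem leftPart_apply (a : Fin N → ℝ) (X : Mat N) (j k : Fin N) :
    leftPart a X j k = if a j = a k then (X j k - star (X k j)) / 2 else 0 := rfl

theorem rightPart_apply (a b : Fin N → ℝ) (X : Mat N) (j k : Fin N) :
    rightPart a b X j k =
      if a j ≠ a k ∧ b j = b k then (X j k - star (X k j)) / 2 else 0 := rfl

theorem conjTranspose_leftPart (a : Fin N → ℝ) (X : Mat N) :
    (leftPart a X)ᴴ = -leftPart a X := by
  ext j k
  rw [conjTranspose_apply, Matrix.neg_apply, leftPart_apply, leftPart_apply]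
  by_cases h : a j = a k
  · rw [if_pos h, if_pos h.symm, star_div₀, star_sub, star_star, star_ofNat]
    ring
  · rw [if_neg h, if_neg (Ne.symm h), star_zero, neg_zero]

theorem conjTranspose_rightPart (a b : Fin N → ℝ) (X : Mat N) :
    (rightPart a b X)ᴴ = -rightPart a b X := by
  ext j k
  rw [conjTranspose_apply, Matrix.neg_apply, rightPart_apply, rightPart_apply]
  by_cases h : a j ≠ a k ∧ b j = b k
  · rw [if_pos h, if_pos ⟨h.1.symm, h.2.symm⟩, star_div₀, star_sub, star_star, star_ofNat]
    ring
  · rw [if_neg h, if_neg fun h' => h ⟨h'.1.symm, h'.2.symm⟩, star_zero, neg_zero]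

theorem commute_leftPart (a : Fin N → ℝ) (X : Mat N) : Commute (leftPart a X) (realDiag a) :=
  commute_realDiag_iff.2 fun _ _ h => if_neg h

theorem commute_rightPart (a b : Fin N → ℝ) (X : Mat N) :
    Commute (rightPart a b X) (realDiag b) :=
  commute_realDiag_iff.2 fun _ _ h => if_neg fun h' => h h'.2

theorem leftPart_add_rightPart_mem (a b : Fin N → ℝ) (X : Mat N) :
    leftPart a X + rightPart a b X ∈ tangentModel a b := by
  refine ⟨by rw [conjTranspose_add, conjTranspose_leftPart, conjTranspose_rightPart, neg_add],
    fun j k h h' => ?_⟩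
  rw [Matrix.add_apply, leftPart_apply, rightPart_apply, if_neg h, if_neg fun h'' => h' h''.2,
    add_zero]

/-- Entries lying in blocks of both `a` and `b` are assigned to the left part alone, so nothing is
counted twice. Together with `leftPart_add_rightPart_mem` this makes `leftPart a + rightPart a b` a
projection onto `tangentModel a b`. -/
theorem leftPart_add_rightPart {a b : Fin N → ℝ} {X : Mat N} (hX : X ∈ tangentModel a b) :
    leftPart a X + rightPart a b X = X := by
  ext j k
  have h1 : star (X k j) = -X j k := congrFun (congrFun hX.1 j) k
  rw [Matrix.add_apply, leftPart_apply, rightPart_apply, h1]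
  by_cases h : a j = a k
  · simp [h]
  · by_cases h' : b j = b k
    · simp [h, h']
    · simp [h, h', hX.2 j k h h']

theorem leftPart_eq_self {a : Fin N → ℝ} {X : Mat N} (hX : X ∈ skewModel N)
    (h : Commute X (realDiag a)) : leftPart a X = X := by
  ext j k
  have h1 : star (X k j) = -X j k := congrFun (congrFun hX j) k
  rw [leftPart_apply, h1]
  by_cases hjk : a j = a k
  · simp [hjk]
  · simp [hjk, commute_realDiag_iff.1 h j k hjk]

section Exp

attribute [local instance] Matrix.frobeniusNormedRing Matrix.frobeniusNormedAlgebra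

open NormedSpace (exp)

theorem contDiff_matrix_exp : ContDiff ℝ ∞ (exp : Mat N → Mat N) :=
  contDiff_iff_contDiffAt.2 fun x => (NormedSpace.exp_analytic x).contDiffAt

theorem hasFDerivAt_matrix_exp_zero :
    HasFDerivAt (exp : Mat N → Mat N) (ContinuousLinearMap.id ℝ (Mat N)) 0 :=
  (hasStrictFDerivAt_exp_zero (𝕂 := ℝ) (𝔸 := Mat N)).hasFDerivAt

theorem hasDerivAt_matrix_exp_smul (K : Mat N) (t : ℝ) :
    HasDerivAt (fun s : ℝ => exp (s • K)) (exp (t • K) * K) t :=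
  hasDerivAt_exp_smul_const K t

theorem contDiff_matrix_exp_smul (K : Mat N) : ContDiff ℝ ∞ fun s : ℝ => exp (s • K) :=
  contDiff_matrix_exp.comp (contDiff_id.smul contDiff_const)

theorem commute_exp {K D : Mat N} (h : Commute K D) : Commute (exp K) D :=
  Commute.exp_left h

theorem exp_neg_mul_exp (K : Mat N) : exp (-K) * exp K = 1 := by
  rw [← Matrix.exp_add_of_commute _ _ (Commute.neg_left (Commute.refl K)), neg_add_cancel,
    NormedSpace.exp_zero]

theorem exp_mul_exp_neg (K : Mat N) : exp K * exp (-K) = 1 := by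
  have h := exp_neg_mul_exp (-K)
  rwa [neg_neg] at h

theorem conjTranspose_exp {K : Mat N} (h : Kᴴ = -K) : (exp K)ᴴ = exp (-K) := by
  rw [← Matrix.exp_conjTranspose, h]

theorem exp_mem_unitarySet {K : Mat N} (h : Kᴴ = -K) : exp K ∈ unitarySet N := by
  refine mem_unitaryGroup_iff.2 ?_
  rw [star_eq_conjTranspose, conjTranspose_exp h]
  exact exp_mul_exp_neg K

theorem exp_mem_blockUnitary {a : Fin N → ℝ} {K : Mat N} (h : Kᴴ = -K)
    (hc : Commute K (realDiag a)) : exp K ∈ blockUnitary a :=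
  mem_blockUnitary_iff.2 ⟨exp_mem_unitarySet h, commute_exp hc⟩

end Exp

section Orbit

attribute [local instance] Matrix.frobeniusNormedRing Matrix.frobeniusNormedAlgebra

open NormedSpace (exp)

/-! ### Tangent spaces of the unitary group and of the critical submanifolds -/

theorem mem_tangentSpace_unitarySet {U X : Mat N} (hU : U ∈ unitarySet N) :
    X ∈ tangentSpace (unitarySet N) U ↔ Uᴴ * X ∈ skewModel N := by
  constructor
  · suffices h : tangentSpace (unitarySet N) U ≤
        (skewModel N).comap (LinearMap.mulLeft ℝ (Uᴴ : Mat N)) from fun hX => h hX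
    refine tangentSpace_le fun γ v hγ hC h0 => ?_
    have h1 : HasDerivAt (fun s => (γ s)ᴴ * γ s) (vᴴ * U + Uᴴ * v) 0 := by
      have h2 := hγ.star.mul hγ
      simp only [h0] at h2
      exact h2
    have h3 : (fun s => (γ s)ᴴ * γ s) =ᶠ[𝓝 0] fun _ => 1 :=
      hC.mono fun s hs => conjTranspose_mul_self hs
    have h4 := h1.unique ((hasDerivAt_const 0 (1 : Mat N)).congr_of_eventuallyEq h3)
    change (Uᴴ * v)ᴴ = -(Uᴴ * v)
    rw [conjTranspose_mul, conjTranspose_conjTranspose]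
    exact eq_neg_of_add_eq_zero_left h4
  · intro hX
    refine deriv_mem_tangentSpace (γ := fun s => U * exp (s • (Uᴴ * X))) ?_ ?_ ?_ ?_
    · exact (contDiff_const.mul (contDiff_matrix_exp_smul _)).contDiffAt
    · refine Filter.Eventually.of_forall fun s => mul_mem_unitarySet hU (exp_mem_unitarySet ?_)
      rw [conjTranspose_smul, hX, star_trivial, smul_neg]
    · simp
    · have h := (hasDerivAt_matrix_exp_smul (Uᴴ * X) 0).const_mul U
      rw [zero_smul, NormedSpace.exp_zero, one_mul, mul_conjTranspose_cancel hU] at h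
      exact h

/-- The set `g U(a) U(b) h`. -/
def orbit (a b : Fin N → ℝ) (g h : Mat N) : Set (Mat N) :=
  {U | ∃ u ∈ blockUnitary a, ∃ v ∈ blockUnitary b, U = g * u * v * h}

/-- Any point of the orbit can serve as its base point: `g u v h` becomes `g' h'` for the same
orbit. Local statements are therefore needed only at `g * h`. -/
theorem orbit_mul_mul {a b : Fin N → ℝ} {g h u v : Mat N} (hu : u ∈ blockUnitary a)
    (hv : v ∈ blockUnitary b) : orbit a b (g * u) (v * h) = orbit a b g h := by
  ext U
  constructor
  · rintro ⟨u', hu', v', hv', rfl⟩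
    exact ⟨u * u', mul_mem_blockUnitary hu hu', v' * v, mul_mem_blockUnitary hv' hv,
      by simp only [mul_assoc]⟩
  · rintro ⟨u', hu', v', hv', rfl⟩
    refine ⟨uᴴ * u', mul_mem_blockUnitary (conjTranspose_mem_blockUnitary hu) hu',
      v' * vᴴ, mul_mem_blockUnitary hv' (conjTranspose_mem_blockUnitary hv), ?_⟩
    simp only [mul_assoc, mul_conjTranspose_cancel hu.1, conjTranspose_mul_cancel hv.1]

theorem orbit_subset_unitarySet {a b : Fin N → ℝ} {g h : Mat N} (hg : g ∈ unitarySet N)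
    (hh : h ∈ unitarySet N) : orbit a b g h ⊆ unitarySet N := by
  rintro U ⟨u, hu, v, hv, rfl⟩
  exact mul_mem_unitarySet (mul_mem_unitarySet (mul_mem_unitarySet hg hu.1) hv.1) hh

/-- The expressions `Q Q†` and `[Q b Q†, a]`, which are constant on `U(a) U(b)`. -/
def orbitEquation (a b : Fin N → ℝ) (Q : Mat N) : Mat N × Mat N :=
  (Q * Qᴴ, Q * realDiag b * Qᴴ * realDiag a - realDiag a * (Q * realDiag b * Qᴴ))

theorem orbitEquation_eq {a b : Fin N → ℝ} {u v : Mat N} (hu : u ∈ blockUnitary a)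
    (hv : v ∈ blockUnitary b) : orbitEquation a b (u * v) = (1, 0) := by
  refine Prod.ext (mul_conjTranspose_self (mul_mem_unitarySet hu.1 hv.1)) ?_
  exact sub_eq_zero.2 (commute_conj_of_mem_blockUnitary hu hv).eq

theorem hasDerivAt_orbitEquation (a b : Fin N → ℝ) {q : ℝ → Mat N} {x : Mat N}
    (hq : HasDerivAt q x 0) (h0 : q 0 = 1) :
    HasDerivAt (fun s => orbitEquation a b (q s))
      (x + xᴴ, (x * realDiag b + realDiag b * xᴴ) * realDiag a -
        realDiag a * (x * realDiag b + realDiag b * xᴴ)) 0 := by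
  have h1 : HasDerivAt (fun s => q s * (q s)ᴴ) (x + xᴴ) 0 := by
    have h := hq.mul hq.star
    simp only [h0, star_one, mul_one, one_mul] at h
    exact h
  have h2 : HasDerivAt (fun s => q s * realDiag b * (q s)ᴴ)
      (x * realDiag b + realDiag b * xᴴ) 0 := by
    have h := (hq.mul_const (realDiag b)).mul hq.star
    simp only [h0, star_one, mul_one, one_mul] at h
    exact h
  exact h1.prodMk ((h2.mul_const _).sub (h2.const_mul _))

theorem differentiable_orbitEquation (a b : Fin N → ℝ) :
    Differentiable ℝ (orbitEquation a b : Mat N → _) := by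
  have h0 : Differentiable ℝ fun Q : Mat N => Qᴴ := differentiable_id.star
  have h1 : Differentiable ℝ fun Q : Mat N => Q * realDiag b * Qᴴ :=
    (differentiable_id.mul_const _).mul h0
  exact (differentiable_id.mul h0).prodMk ((h1.mul_const _).sub (h1.const_mul _))

/-- The first component makes `x` skew-Hermitian; the second then reads `[[x, b], a] = 0`, with
entries `(a k - a j) (b k - b j) x j k`. So the kernel of the linearised orbit equation is no larger
than the tangent model, although the equation is only known to hold on the orbit, not to define it.
-/
theorem mem_tangentModel_of_derivative {a b : Fin N → ℝ} {x : Mat N}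
    (h : (x + xᴴ, (x * realDiag b + realDiag b * xᴴ) * realDiag a -
        realDiag a * (x * realDiag b + realDiag b * xᴴ)) = (0 : Mat N × Mat N)) :
    x ∈ tangentModel a b := by
  obtain ⟨h1, h2⟩ := Prod.ext_iff.1 h
  have hx : xᴴ = -x := eq_neg_of_add_eq_zero_right h1
  refine ⟨hx, fun j k ha hb => ?_⟩
  have h3 := commute_realDiag_iff.1 (sub_eq_zero.1 h2) j k ha
  rw [hx, Matrix.add_apply, mul_diagonal, diagonal_mul, Matrix.neg_apply] at h3
  have h4 : x j k * ((b k : ℂ) - b j) = 0 := by linear_combination h3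
  rcases mul_eq_zero.1 h4 with h5 | h5
  · exact h5
  · exact absurd (Complex.ofReal_injective (sub_eq_zero.1 h5)).symm hb

/-- The linearised orbit equation bounds the tangent space from above; the curves `g exp(s L x)
exp(s R x) h` realise every vector of that bound. -/
theorem mem_tangentSpace_orbit {a b : Fin N → ℝ} {g h X : Mat N} (hg : g ∈ unitarySet N)
    (hh : h ∈ unitarySet N) :
    X ∈ tangentSpace (orbit a b g h) (g * h) ↔ gᴴ * X * hᴴ ∈ tangentModel a b := by
  constructor
  · suffices hle : tangentSpace (orbit a b g h) (g * h) ≤ (tangentModel a b).comap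
        ((LinearMap.mulRight ℝ (hᴴ : Mat N)).comp (LinearMap.mulLeft ℝ (gᴴ : Mat N))) from
      fun hX => hle hX
    refine tangentSpace_le fun γ v hγ hC h0 => ?_
    change gᴴ * v * hᴴ ∈ tangentModel a b
    have hq : HasDerivAt (fun s => gᴴ * γ s * hᴴ) (gᴴ * v * hᴴ) 0 :=
      (hγ.const_mul _).mul_const _
    have h1 := hasDerivAt_orbitEquation a b hq (by
      simp only [h0, conjTranspose_mul_cancel hg, mul_conjTranspose_self hh])
    have h2 : (fun s => orbitEquation a b (gᴴ * γ s * hᴴ)) =ᶠ[𝓝 0] fun _ => (1, 0) := by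
      refine hC.mono ?_
      rintro s ⟨u, hu, v, hv, hs⟩
      change orbitEquation a b (gᴴ * γ s * hᴴ) = (1, 0)
      rw [hs, ← orbitEquation_eq hu hv]
      simp only [mul_assoc, conjTranspose_mul_cancel hg, mul_conjTranspose_self hh, mul_one]
    exact mem_tangentModel_of_derivative
      (h1.unique ((hasDerivAt_const _ _).congr_of_eventuallyEq h2))
  · intro hX
    set x := gᴴ * X * hᴴ with hx
    have hXx : g * x * h = X := by
      simp only [hx, mul_assoc, conjTranspose_mul_self hh, mul_conjTranspose_cancel hg, mul_one]
    refine deriv_mem_tangentSpace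
      (γ := fun s => g * exp (s • leftPart a x) * exp (s • rightPart a b x) * h) ?_ ?_ ?_ ?_
    · exact (((contDiff_const.mul (contDiff_matrix_exp_smul _)).mul
        (contDiff_matrix_exp_smul _)).mul contDiff_const).contDiffAt
    · refine Filter.Eventually.of_forall fun s => ⟨_, ?_, _, ?_, rfl⟩
      · rw [← map_smul]
        exact exp_mem_blockUnitary (conjTranspose_leftPart _ _) (commute_leftPart _ _)
      · rw [← map_smul]
        exact exp_mem_blockUnitary (conjTranspose_rightPart _ _ _) (commute_rightPart _ _ _)
    · simp
    · have h := (((hasDerivAt_matrix_exp_smul (leftPart a x) 0).const_mul g).mul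
        (hasDerivAt_matrix_exp_smul (rightPart a b x) 0)).mul_const h
      simp only [zero_smul, NormedSpace.exp_zero, one_mul, mul_one] at h
      rw [← mul_add, leftPart_add_rightPart hX, hXx] at h
      exact h

/-! ### Slice charts -/

/-- The linear isomorphism `x ↦ g x h`, for unitary `g` and `h`. -/
def sandwich {g h : Mat N} (hg : g ∈ unitarySet N) (hh : h ∈ unitarySet N) :
    Mat N ≃L[ℝ] Mat N :=
  LinearEquiv.toContinuousLinearEquiv
    { toFun := fun x => g * x * h
      invFun := fun x => gᴴ * x * hᴴ
      map_add' := fun x y => by rw [mul_add, add_mul]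
      map_smul' := fun r x => by rw [mul_smul_comm, smul_mul_assoc, RingHom.id_apply]
      left_inv := fun x => by
        simp only [mul_assoc, conjTranspose_mul_cancel hg, mul_conjTranspose_self hh, mul_one]
      right_inv := fun x => by
        simp only [mul_assoc, mul_conjTranspose_cancel hg, conjTranspose_mul_self hh, mul_one] }

/-- A parametrisation of a neighbourhood of `g h`, adapted to `g U(a) U(b) h`. -/
def sliceMap (a b : Fin N → ℝ) (g h x : Mat N) : Mat N :=
  g * exp (leftPart a x) * (1 + (x - (leftPart a x + rightPart a b x))) *
    exp (rightPart a b x) * h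

theorem contDiff_exp_linear (l : Mat N →ₗ[ℝ] Mat N) : ContDiff ℝ ∞ fun x => exp (l x) :=
  contDiff_matrix_exp.comp (LinearMap.toContinuousLinearMap l).contDiff

theorem contDiff_sliceMap (a b : Fin N → ℝ) (g h : Mat N) : ContDiff ℝ ∞ (sliceMap a b g h) := by
  have h1 : ContDiff ℝ ∞ fun x : Mat N => 1 + (x - (leftPart a x + rightPart a b x)) :=
    contDiff_const.add (contDiff_id.sub
      ((LinearMap.toContinuousLinearMap (leftPart a + rightPart a b)).contDiff))
  exact (((contDiff_const.mul (contDiff_exp_linear _)).mul h1).mul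
    (contDiff_exp_linear _)).mul contDiff_const

theorem sliceMap_zero (a b : Fin N → ℝ) (g h : Mat N) : sliceMap a b g h 0 = g * h := by
  simp [sliceMap]

/-- To first order the three inner factors contribute `L x`, `x - L x - R x` and `R x`, which add up
to `x`. -/
theorem hasFDerivAt_sliceMap (a b : Fin N → ℝ) {g h : Mat N} (hg : g ∈ unitarySet N)
    (hh : h ∈ unitarySet N) :
    HasFDerivAt (sliceMap a b g h) (sandwich hg hh : Mat N →L[ℝ] Mat N) 0 := by
  have h1 := ((contDiff_sliceMap a b g h).differentiable (by simp) 0).hasFDerivAt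
  suffices h2 : fderiv ℝ (sliceMap a b g h) 0 = (sandwich hg hh : Mat N →L[ℝ] Mat N) by
    exact h1.congr_fderiv h2
  ext1 v
  have h4 := hasDerivAt_comp_add_smul h1 v
  have h5 := hasDerivAt_add_smul 1 (v - (leftPart a v + rightPart a b v))
  have h6 := ((((hasDerivAt_matrix_exp_smul (leftPart a v) 0).const_mul g).mul h5).mul
    (hasDerivAt_matrix_exp_smul (rightPart a b v) 0)).mul_const h
  have h7 : (fun s : ℝ => sliceMap a b g h (0 + s • v)) = fun s : ℝ =>
      g * exp (s • leftPart a v) * (1 + s • (v - (leftPart a v + rightPart a b v))) *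
        exp (s • rightPart a b v) * h := by
    funext s
    simp only [sliceMap, zero_add, map_smul, smul_sub, smul_add]
  rw [h7] at h4
  refine (h4.unique h6).trans ?_
  change _ = g * v * h
  simp only [Pi.mul_apply, zero_smul, NormedSpace.exp_zero, one_mul, mul_one, add_zero]
  rw [← mul_add, ← mul_add]
  congr 2
  abel

/-- Let `r = x - L x - R x`, which lies in the kernel of the projection `L + R`. Cancelling the
exponentials, `sliceMap a b g h x` is in the orbit only if `1 + r` is in `U(a) U(b)`, so that
`orbitEquation` takes the same value at `1 + r` and at `1`. Its derivative at `1` is injective on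
that kernel, so small `r` must be zero. No local closedness of the orbit has to be known beforehand.
-/
theorem eventually_sliceMap_mem_orbit_iff (a b : Fin N → ℝ) {g h : Mat N}
    (hg : g ∈ unitarySet N) (hh : h ∈ unitarySet N) :
    ∀ᶠ x in 𝓝 (0 : Mat N), (sliceMap a b g h x ∈ orbit a b g h ↔ x ∈ tangentModel a b) := by
  have hf : HasFDerivAt (orbitEquation a b) (fderiv ℝ (orbitEquation a b) 1) (1 : Mat N) :=
    (differentiable_orbitEquation a b 1).hasFDerivAt
  have hR : ∀ v ∈ LinearMap.ker (leftPart a + rightPart a b),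
      fderiv ℝ (orbitEquation a b) 1 v = 0 → v = 0 := by
    intro v hv hv0
    have h4 := hasDerivAt_comp_add_smul hf v
    have h5 := h4.unique (hasDerivAt_orbitEquation a b (hasDerivAt_add_smul 1 v) (by simp))
    rw [← leftPart_add_rightPart (mem_tangentModel_of_derivative (h5.symm.trans hv0))]
    exact hv
  have h1 := eventually_eq_zero_of_ker_inf_eq_bot hf hR
  have hc : Filter.Tendsto (fun x : Mat N => x - (leftPart a x + rightPart a b x))
      (𝓝 0) (𝓝 0) := by
    have h2 : Continuous fun x : Mat N => x - (leftPart a x + rightPart a b x) :=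
      continuous_id.sub
        (LinearMap.toContinuousLinearMap (leftPart a + rightPart a b)).continuous
    simpa using h2.tendsto 0
  refine (hc.eventually h1).mono fun x hx => ⟨?_, fun hxT => ?_⟩
  · rintro ⟨u, hu, v, hv, huv⟩
    set r := x - (leftPart a x + rightPart a b x) with hr
    have hrR : r ∈ LinearMap.ker (leftPart a + rightPart a b) := by
      rw [LinearMap.mem_ker, hr, map_sub, sub_eq_zero, LinearMap.add_apply, LinearMap.add_apply,
        leftPart_add_rightPart (leftPart_add_rightPart_mem a b x)]
    have hA := exp_mem_blockUnitary (conjTranspose_leftPart a x) (commute_leftPart a x)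
    have hB := exp_mem_blockUnitary (conjTranspose_rightPart a b x) (commute_rightPart a b x)
    have hq : 1 + r = ((exp (leftPart a x))ᴴ * u) * (v * (exp (rightPart a b x))ᴴ) := by
      have h3 := congrArg (fun M => (exp (leftPart a x))ᴴ * (gᴴ * M * hᴴ) *
        (exp (rightPart a b x))ᴴ) huv
      simp only [sliceMap, ← hr, mul_assoc, conjTranspose_mul_cancel hg,
        mul_conjTranspose_cancel hh, conjTranspose_mul_cancel hA.1,
        mul_conjTranspose_self hB.1, mul_one] at h3
      simpa only [mul_assoc] using h3
    have h0 : r = 0 := by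
      refine hx hrR ?_
      rw [hq, orbitEquation_eq (mul_mem_blockUnitary (conjTranspose_mem_blockUnitary hA) hu)
        (mul_mem_blockUnitary hv (conjTranspose_mem_blockUnitary hB))]
      have h3 := orbitEquation_eq (one_mem_blockUnitary a) (one_mem_blockUnitary b)
      rw [mul_one] at h3
      exact h3.symm
    rw [sub_eq_zero.1 h0]
    exact leftPart_add_rightPart_mem a b x
  · refine ⟨_, exp_mem_blockUnitary (conjTranspose_leftPart a x) (commute_leftPart a x), _,
      exp_mem_blockUnitary (conjTranspose_rightPart a b x) (commute_rightPart a b x), ?_⟩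
    rw [sliceMap, leftPart_add_rightPart hxT, sub_self, add_zero, mul_one]

theorem isEmbeddedSubmanifold_orbit (a b : Fin N → ℝ) {g h : Mat N} (hg : g ∈ unitarySet N)
    (hh : h ∈ unitarySet N) : IsEmbeddedSubmanifold (orbit a b g h) := by
  rintro U ⟨u, hu, v, hv, rfl⟩
  have hg' := mul_mem_unitarySet hg hu.1
  have hh' := mul_mem_unitarySet hv.1 hh
  obtain ⟨e, h0, h1, h2, h3, -⟩ := exists_slice_chart (contDiff_sliceMap a b (g * u) (v * h))
    (hasFDerivAt_sliceMap a b hg' hh') (eventually_sliceMap_mem_orbit_iff a b hg' hh')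
  rw [sliceMap_zero, ← mul_assoc] at h0
  rw [orbit_mul_mul hu hv] at h3
  exact ⟨e, _, h0, h1, h2, h3⟩

/-! ### The second fundamental form -/

/-- The derivative of the moving frame along `g U(a) U(b) h`. -/
def frameDeriv (a b : Fin N → ℝ) (g h : Mat N) : Mat N →ₗ[ℝ] Mat N →ₗ[ℝ] Mat N :=
  LinearMap.mk₂ ℝ (fun X Y => g * (leftPart a (gᴴ * X * hᴴ) * (gᴴ * Y * hᴴ) +
      gᴴ * Y * hᴴ * rightPart a b (gᴴ * X * hᴴ)) * h)
    (fun X X' Y => by simp only [mul_add, add_mul, map_add]; abel)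
    (fun r X Y => by
      simp only [mul_smul_comm, smul_mul_assoc, map_smul, mul_add, add_mul, smul_add])
    (fun X Y Y' => by simp only [mul_add, add_mul]; abel)
    (fun r X Y => by simp only [mul_smul_comm, smul_mul_assoc, mul_add, add_mul, smul_add])

theorem frameDeriv_apply (a b : Fin N → ℝ) (g h X Y : Mat N) :
    frameDeriv a b g h X Y = g * (leftPart a (gᴴ * X * hᴴ) * (gᴴ * Y * hᴴ) +
      gᴴ * Y * hᴴ * rightPart a b (gᴴ * X * hᴴ)) * h := rfl

theorem hasDerivAt_exp_linear (l : Mat N →ₗ[ℝ] Mat N) {x : ℝ → Mat N} {x' : Mat N}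
    (hx : HasDerivAt x x' 0) (h0 : x 0 = 0) :
    HasDerivAt (fun s => exp (l (x s))) (l x') 0 := by
  have h1 : HasDerivAt (fun s => l (x s)) (l x') 0 :=
    (LinearMap.toContinuousLinearMap l).hasFDerivAt.comp_hasDerivAt 0 hx
  have h2 : HasFDerivAt (exp : Mat N → Mat N) (ContinuousLinearMap.id ℝ (Mat N)) (l (x 0)) := by
    rw [h0, map_zero]
    exact hasFDerivAt_matrix_exp_zero
  exact h2.comp_hasDerivAt 0 h1

/-- Near `g h` a point of the orbit is `g A B h`, where the chart `e` supplies `A = exp (L (e q))`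
and `B = exp (R (e q))`. The frame `Φ` conjugates into the model, multiplies by `A` on the left and
`B` on the right, and returns; `Ψ` uses the inverse exponentials. Both preserve tangency because `(g
A, B h)` is again a base point of the same orbit. As `e` is defined on an open set of matrices, the
frame is smooth off the orbit too. -/
theorem isSecondFundamentalForm_orbit (a b : Fin N → ℝ) {g h : Mat N} (hg : g ∈ unitarySet N)
    (hh : h ∈ unitarySet N) :
    IsSecondFundamentalForm (unitarySet N) (orbit a b g h) (g * h)
      (normalPart (unitarySet N) (orbit a b g h) (g * h) (frameDeriv a b g h)) := by
  obtain ⟨e, h0, h1, -, h3, h4, h5, h6⟩ := exists_slice_chart (contDiff_sliceMap a b g h)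
    (hasFDerivAt_sliceMap a b hg hh) (eventually_sliceMap_mem_orbit_iff a b hg hh)
  rw [sliceMap_zero] at h0 h5 h6
  have hes : ContDiffAt ℝ ∞ e (g * h) := h1.contDiffAt (e.open_source.mem_nhds h0)
  have hC : ∀ᶠ q in 𝓝[orbit a b g h] (g * h), ∃ A ∈ blockUnitary a, ∃ B ∈ blockUnitary b,
      A = exp (leftPart a (e q)) ∧ B = exp (rightPart a b (e q)) ∧
      ∀ X, X ∈ tangentSpace (orbit a b g h) q ↔
        (g * A)ᴴ * X * (B * h)ᴴ ∈ tangentModel a b := by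
    filter_upwards [self_mem_nhdsWithin, mem_nhdsWithin_of_mem_nhds (e.open_source.mem_nhds h0)]
      with q hq hqs
    have hA := exp_mem_blockUnitary (conjTranspose_leftPart a (e q)) (commute_leftPart a (e q))
    have hB := exp_mem_blockUnitary (conjTranspose_rightPart a b (e q))
      (commute_rightPart a b (e q))
    refine ⟨_, hA, _, hB, rfl, rfl, fun X => ?_⟩
    have hq' : q = g * exp (leftPart a (e q)) * (exp (rightPart a b (e q)) * h) := by
      conv_lhs => rw [← h4 q hqs]
      rw [sliceMap, leftPart_add_rightPart ((h3 q hqs).1 hq), sub_self, add_zero, mul_one,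
        mul_assoc _ _ h]
    have h7 := mem_tangentSpace_orbit (a := a) (b := b) (X := X) (mul_mem_unitarySet hg hA.1)
      (mul_mem_unitarySet hB.1 hh)
    rwa [orbit_mul_mul hA hB, ← hq'] at h7
  have hexp : ∀ l : Mat N →ₗ[ℝ] Mat N, ContDiffAt ℝ ∞ (fun q => exp (l (e q))) (g * h) :=
    fun l => (contDiff_exp_linear l).contDiffAt.comp _ hes
  refine isSecondFundamentalForm_normalPart (orbit_subset_unitarySet hg hh)
    (Φ := fun q Y => g * exp (leftPart a (e q)) * (gᴴ * Y * hᴴ) * exp (rightPart a b (e q)) * h)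
    (Ψ := fun q W => g * exp ((-leftPart a) (e q)) * (gᴴ * W * hᴴ) *
      exp ((-rightPart a b) (e q)) * h) ?_ ?_ ?_ ?_ ?_
  · intro Y
    exact (((contDiffAt_const.mul (hexp _)).mul contDiffAt_const).mul (hexp _)).mul
      contDiffAt_const
  · intro Y
    simp only [h5, map_zero, NormedSpace.exp_zero, mul_one, mul_assoc,
      mul_conjTranspose_cancel hg, conjTranspose_mul_self hh]
  · refine hC.mono ?_
    rintro q ⟨A, hA, B, hB, hA', hB', hT⟩ Y hY
    rw [hT, ← hA', ← hB']
    rw [mem_tangentSpace_orbit hg hh] at hY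
    simpa only [conjTranspose_mul, mul_assoc, conjTranspose_mul_cancel hg,
      mul_conjTranspose_cancel hh, conjTranspose_mul_cancel hA.1,
      mul_conjTranspose_self hB.1, mul_one] using hY
  · intro γ y v y' hγ0 hγ hy
    have h8 : HasFDerivAt e ((sandwich hg hh).symm : Mat N →L[ℝ] Mat N) (γ 0) := by
      rw [hγ0]
      exact h6
    have hx : HasDerivAt (fun s => e (γ s)) (gᴴ * v * hᴴ) 0 := h8.comp_hasDerivAt 0 hγ
    have hx0 : e (γ 0) = 0 := by rw [hγ0, h5]
    have h7 := ((((hasDerivAt_exp_linear (-leftPart a) hx hx0).const_mul g).mul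
      ((hy.const_mul gᴴ).mul_const hᴴ)).mul
      (hasDerivAt_exp_linear (-rightPart a b) hx hx0)).mul_const h
    refine h7.congr_deriv ?_
    simp only [Pi.mul_apply, hx0, map_zero, neg_zero, NormedSpace.exp_zero, mul_one, frameDeriv_apply,
      LinearMap.neg_apply, mul_neg, neg_mul, mul_add, add_mul, mul_assoc,
      mul_conjTranspose_cancel hg, conjTranspose_mul_self hh]
    abel
  · refine hC.mono ?_
    rintro q ⟨A, hA, B, hB, hA', hB', hT⟩ W hW
    rw [hT] at hW
    rw [mem_tangentSpace_orbit hg hh, LinearMap.neg_apply, LinearMap.neg_apply,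
      ← conjTranspose_exp (conjTranspose_leftPart _ _),
      ← conjTranspose_exp (conjTranspose_rightPart _ _ _), ← hA', ← hB']
    simpa only [conjTranspose_mul, mul_assoc, conjTranspose_mul_cancel hg,
      mul_conjTranspose_self hh, mul_one] using hW

end Orbit

/-! ### The natural basis -/

theorem inner_mat (A B : Mat N) : inner ℝ A B = (trace (Aᴴ * B)).re := rfl

theorem inner_single (i j : Fin N) (c : ℂ) (K : Mat N) :
    inner ℝ (single i j c) K = (star c * K i j).re := by
  rw [inner_mat, conjTranspose_single, trace_single_mul, smul_eq_mul]

theorem inner_eq_zero_of_disjoint {x z : Mat N} (h : ∀ j k, x j k = 0 ∨ z j k = 0) :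
    inner ℝ x z = 0 := by
  rw [inner_mat, trace, Complex.re_sum]
  refine Finset.sum_eq_zero fun i _ => ?_
  rw [diag_apply, mul_apply, Complex.re_sum]
  refine Finset.sum_eq_zero fun j _ => ?_
  rcases h j i with h | h
  · rw [conjTranspose_apply, h, star_zero, zero_mul, Complex.zero_re]
  · rw [h, mul_zero, Complex.zero_re]

theorem inner_sandwich {g h : Mat N} (hg : g ∈ unitarySet N) (hh : h ∈ unitarySet N)
    (x y : Mat N) : inner ℝ (g * x * h) (g * y * h) = inner ℝ x y := by
  have h1 : (g * x * h)ᴴ * (g * y * h) = hᴴ * (xᴴ * y * h) := by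
    simp only [conjTranspose_mul, mul_assoc, conjTranspose_mul_cancel hg]
  rw [inner_mat, inner_mat, h1, trace_mul_comm, mul_assoc, mul_conjTranspose_self hh, mul_one]

theorem inner_sandwich_left {g h : Mat N} (hg : g ∈ unitarySet N) (hh : h ∈ unitarySet N)
    (x Y : Mat N) : inner ℝ (g * x * h) Y = inner ℝ x (gᴴ * Y * hᴴ) := by
  have h1 : g * (gᴴ * Y * hᴴ) * h = Y := by
    simp only [mul_assoc, conjTranspose_mul_self hh, mul_conjTranspose_cancel hg, mul_one]
  rw [← inner_sandwich hg hh x, h1]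

theorem skewBasis_diag (l : Fin N) : skewBasis (l, l) = single l l Complex.I := if_pos rfl

theorem skewBasis_of_lt {j k : Fin N} (h : j < k) :
    skewBasis (j, k) = single j k (Complex.I / (Real.sqrt 2 : ℂ)) +
      single k j (Complex.I / (Real.sqrt 2 : ℂ)) := by
  rw [skewBasis, if_neg h.ne, if_pos h]
  simp only [smul_add, smul_single, smul_eq_mul, mul_one]

theorem skewBasis_of_gt {j k : Fin N} (h : j < k) :
    skewBasis (k, j) = single j k (1 / (Real.sqrt 2 : ℂ)) +
      single k j (-(1 / (Real.sqrt 2 : ℂ))) := by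
  rw [skewBasis, if_neg h.ne', if_neg h.not_gt, smul_sub, sub_eq_add_neg, smul_single,
    smul_single, smul_eq_mul, mul_one, single_neg]

theorem skewBasis_cases (p : Fin N × Fin N → Prop) (h1 : ∀ l, p (l, l))
    (h2 : ∀ j k, j < k → p (j, k)) (h3 : ∀ j k, j < k → p (k, j)) (e : Fin N × Fin N) : p e := by
  obtain ⟨j, k⟩ := e
  rcases lt_trichotomy j k with h | rfl | h
  exacts [h2 _ _ h, h1 _, h3 _ _ h]

theorem skewBasis_mem_skewModel (e : Fin N × Fin N) : skewBasis e ∈ skewModel N := by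
  rw [mem_skewModel]
  refine skewBasis_cases (fun e => (skewBasis e)ᴴ = -skewBasis e) (fun l => ?_)
    (fun j k h => ?_) (fun j k h => ?_) e
  · rw [skewBasis_diag, conjTranspose_single]
    simp [single_neg]
  · rw [skewBasis_of_lt h, conjTranspose_add, conjTranspose_single, conjTranspose_single,
      neg_add, add_comm]
    simp [neg_div, single_neg]
  · rw [skewBasis_of_gt h, conjTranspose_add, conjTranspose_single, conjTranspose_single,
      neg_add, add_comm]
    simp [single_neg]

theorem skewBasis_apply_eq_zero {e : Fin N × Fin N} {j k : Fin N} (h : (j, k) ≠ e)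
    (h' : (k, j) ≠ e) : skewBasis e j k = 0 := by
  revert h h'
  refine skewBasis_cases (fun e => (j, k) ≠ e → (k, j) ≠ e → skewBasis e j k = 0)
    (fun l => ?_) (fun j' k' hlt => ?_) (fun j' k' hlt => ?_) e
  · intro h h'
    rw [skewBasis_diag, single_apply, if_neg]
    rintro ⟨rfl, rfl⟩
    exact h rfl
  · intro h h'
    rw [skewBasis_of_lt hlt, Matrix.add_apply, single_apply, single_apply, if_neg, if_neg,
      add_zero]
    · rintro ⟨rfl, rfl⟩
      exact h' rfl
    · rintro ⟨rfl, rfl⟩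
      exact h rfl
  · intro h h'
    rw [skewBasis_of_gt hlt, Matrix.add_apply, single_apply, single_apply, if_neg, if_neg,
      add_zero]
    · rintro ⟨rfl, rfl⟩
      exact h rfl
    · rintro ⟨rfl, rfl⟩
      exact h' rfl

theorem skewBasis_apply_ne_zero (e : Fin N × Fin N) : skewBasis e e.1 e.2 ≠ 0 := by
  refine skewBasis_cases (fun e => skewBasis e e.1 e.2 ≠ 0) (fun l => ?_)
    (fun j k h => ?_) (fun j k h => ?_) e
  · simp [skewBasis_diag]
  · simp [skewBasis_of_lt h, h.ne, h.ne']
  · simp [skewBasis_of_gt h, h.ne, h.ne']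

theorem inner_skewBasis_diag (l : Fin N) (K : Mat N) :
    inner ℝ (skewBasis (l, l)) K = (K l l).im := by
  rw [skewBasis_diag, inner_single]
  simp

/-- The entries at `(j, k)` and `(k, j)` of a skew-Hermitian matrix contribute equally, `1/√2` times
the imaginary part each; hence the factor `√2`. -/
theorem inner_skewBasis_of_lt {j k : Fin N} (h : j < k) {K : Mat N} (hK : K ∈ skewModel N) :
    inner ℝ (skewBasis (j, k)) K = Real.sqrt 2 * (K j k).im := by
  have h1 : K k j = -star (K j k) := by
    rw [← conjTranspose_apply, mem_skewModel.1 hK, Matrix.neg_apply, neg_neg]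
  rw [skewBasis_of_lt h, inner_add_left, inner_single, inner_single, h1]
  simp [Complex.div_re, Complex.div_im, Complex.normSq_apply]
  field_simp
  ring

theorem inner_skewBasis_of_gt {j k : Fin N} (h : j < k) {K : Mat N} (hK : K ∈ skewModel N) :
    inner ℝ (skewBasis (k, j)) K = Real.sqrt 2 * (K j k).re := by
  have h1 : K k j = -star (K j k) := by
    rw [← conjTranspose_apply, mem_skewModel.1 hK, Matrix.neg_apply, neg_neg]
  rw [skewBasis_of_gt h, inner_add_left, inner_single, inner_single, h1]
  simp [Complex.inv_re, Complex.inv_im, Complex.normSq_apply]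
  field_simp
  ring

theorem apply_eq_zero_of_inner_skewBasis {K : Mat N} (hK : K ∈ skewModel N) {j k : Fin N}
    (h : inner ℝ (skewBasis (j, k)) K = 0) (h' : inner ℝ (skewBasis (k, j)) K = 0) :
    K j k = 0 := by
  have h1 : ∀ j k, K k j = -star (K j k) := fun j k => by
    rw [← conjTranspose_apply, mem_skewModel.1 hK, Matrix.neg_apply, neg_neg]
  have h2 : Real.sqrt 2 ≠ 0 := by positivity
  rcases lt_trichotomy j k with hlt | rfl | hlt
  · rw [inner_skewBasis_of_lt hlt hK] at h
    rw [inner_skewBasis_of_gt hlt hK] at h'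
    exact Complex.ext ((mul_eq_zero.1 h').resolve_left h2) ((mul_eq_zero.1 h).resolve_left h2)
  · rw [inner_skewBasis_diag] at h
    refine Complex.ext ?_ h
    have h3 := congrArg Complex.re (h1 j j)
    simp only [Complex.neg_re, Complex.star_def, Complex.conj_re] at h3
    rw [Complex.zero_re]
    linarith
  · rw [inner_skewBasis_of_gt hlt hK] at h
    rw [inner_skewBasis_of_lt hlt hK] at h'
    have h3 : K k j = 0 :=
      Complex.ext ((mul_eq_zero.1 h).resolve_left h2) ((mul_eq_zero.1 h').resolve_left h2)
    rw [h1 k j, h3, star_zero, neg_zero]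

theorem norm_skewBasis (e : Fin N × Fin N) :
    inner ℝ (skewBasis e) (skewBasis e) = 1 := by
  have h2 : Real.sqrt 2 * (Real.sqrt 2 / 2) = 1 := by
    rw [mul_div_assoc', Real.mul_self_sqrt (by norm_num), div_self two_ne_zero]
  refine skewBasis_cases (fun e => inner ℝ (skewBasis e) (skewBasis e) = 1) (fun l => ?_)
    (fun j k h => ?_) (fun j k h => ?_) e
  · rw [inner_skewBasis_diag, skewBasis_diag]
    simp
  · rw [inner_skewBasis_of_lt h (skewBasis_mem_skewModel _), skewBasis_of_lt h]
    simpa [h.ne', Complex.div_im, Complex.normSq_apply] using h2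
  · rw [inner_skewBasis_of_gt h (skewBasis_mem_skewModel _), skewBasis_of_gt h]
    simpa [h.ne', Complex.inv_re, Complex.normSq_apply] using h2

/-- Supports are disjoint unless the indices are swaps of each other; in that case one matrix is
real and the other purely imaginary. -/
theorem inner_skewBasis_of_ne {e e' : Fin N × Fin N} (h : e ≠ e') :
    inner ℝ (skewBasis e) (skewBasis e') = 0 := by
  by_cases hs : e' = e.swap
  · subst hs
    revert h
    refine skewBasis_cases (fun e => e ≠ e.swap →
      inner ℝ (skewBasis e) (skewBasis e.swap) = 0) (fun l h => absurd rfl h)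
      (fun j k h _ => ?_) (fun j k h _ => ?_) e
    · rw [inner_skewBasis_of_lt h (skewBasis_mem_skewModel _), Prod.swap_prod_mk,
        skewBasis_of_gt h]
      simp [h.ne', Complex.inv_im]
    · rw [inner_skewBasis_of_gt h (skewBasis_mem_skewModel _), Prod.swap_prod_mk,
        skewBasis_of_lt h]
      simp [h.ne', Complex.div_re]
  · refine inner_eq_zero_of_disjoint fun j k => ?_
    by_contra hjk
    rw [not_or] at hjk
    have h1 : (j, k) = e ∨ (k, j) = e := by
      by_contra hc
      rw [not_or] at hc
      exact hjk.1 (skewBasis_apply_eq_zero hc.1 hc.2)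
    have h2 : (j, k) = e' ∨ (k, j) = e' := by
      by_contra hc
      rw [not_or] at hc
      exact hjk.2 (skewBasis_apply_eq_zero hc.1 hc.2)
    rcases h1 with rfl | rfl <;> rcases h2 with rfl | rfl
    exacts [h rfl, hs rfl, hs rfl, h rfl]

theorem skewBasis_commute_iff {a : Fin N → ℝ} {e : Fin N × Fin N} :
    Commute (skewBasis e) (realDiag a) ↔ a e.1 = a e.2 := by
  rw [commute_realDiag_iff]
  constructor
  · intro h
    by_contra hne
    exact skewBasis_apply_ne_zero e (h _ _ hne)
  · intro h j k hne
    refine skewBasis_apply_eq_zero ?_ ?_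
    · rintro rfl
      exact hne h
    · rintro rfl
      exact hne h.symm

theorem skewBasis_mem_tangentModel {a b : Fin N → ℝ} {e : Fin N × Fin N}
    (h : a e.1 = a e.2 ∨ b e.1 = b e.2) : skewBasis e ∈ tangentModel a b := by
  refine ⟨skewBasis_mem_skewModel e, fun j k ha hb => ?_⟩
  rcases h with h | h
  · exact commute_realDiag_iff.1 (skewBasis_commute_iff.2 h) j k ha
  · exact commute_realDiag_iff.1 (skewBasis_commute_iff.2 h) j k hb

theorem rightPart_eq_zero {a b : Fin N → ℝ} {x : Mat N} (hx : x ∈ tangentModel a b)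
    (hc : Commute x (realDiag a)) : rightPart a b x = 0 := by
  have h := leftPart_add_rightPart hx
  rwa [leftPart_eq_self hx.1 hc, add_eq_left] at h

theorem leftPart_skewBasis_eq_zero {a : Fin N → ℝ} {e : Fin N × Fin N} (h : a e.1 ≠ a e.2) :
    leftPart a (skewBasis e) = 0 := by
  have h0 : ∀ j k, a j = a k → skewBasis e j k = 0 := fun j k hjk => by
    refine skewBasis_apply_eq_zero ?_ ?_
    · rintro rfl
      exact h hjk
    · rintro rfl
      exact h hjk.symm
  ext j k
  rw [leftPart_apply]
  split_ifs with hjk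
  · rw [h0 j k hjk, h0 k j hjk.symm]
    simp
  · rfl

/-! ### Shape operators -/

/-- The bilinear form `(x, y) ↦ ⟨S(x, y), z⟩` of the shape operators, in the model. -/
def shapeForm (a b : Fin N → ℝ) (x y z : Mat N) : ℝ :=
  inner ℝ (leftPart a x * y + y * rightPart a b x) z

theorem shapeForm_of_commute {a b : Fin N → ℝ} {x : Mat N} (hx : x ∈ tangentModel a b)
    (hc : Commute x (realDiag a)) (y z : Mat N) : shapeForm a b x y z = inner ℝ (x * y) z := by
  rw [shapeForm, rightPart_eq_zero hx hc, leftPart_eq_self hx.1 hc, mul_zero, add_zero]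

theorem shapeForm_skewBasis {a b : Fin N → ℝ} {e : Fin N × Fin N} (ha : a e.1 ≠ a e.2)
    (hb : b e.1 = b e.2) (y z : Mat N) :
    shapeForm a b (skewBasis e) y z = inner ℝ (y * skewBasis e) z := by
  have h := leftPart_add_rightPart (skewBasis_mem_tangentModel (a := a) (Or.inr hb))
  rw [leftPart_skewBasis_eq_zero ha, zero_add] at h
  rw [shapeForm, leftPart_skewBasis_eq_zero ha, h, zero_mul, zero_add]

/-- The matrices whose entries vanish where `a` or `b` takes equal values; its skew-Hermitian
members model the normal vectors. -/
def normalModel (a b : Fin N → ℝ) : Set (Mat N) :=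
  {z | ∀ j k, a j = a k ∨ b j = b k → z j k = 0}

theorem inner_eq_zero_of_commute_left {a b : Fin N → ℝ} {x z : Mat N} (hz : z ∈ normalModel a b)
    (hx : Commute x (realDiag a)) : inner ℝ x z = 0 := by
  refine inner_eq_zero_of_disjoint fun j k => ?_
  by_cases h : a j = a k
  · exact Or.inr (hz j k (Or.inl h))
  · exact Or.inl (commute_realDiag_iff.1 hx j k h)

theorem inner_eq_zero_of_commute_right {a b : Fin N → ℝ} {x z : Mat N}
    (hz : z ∈ normalModel a b) (hx : Commute x (realDiag b)) : inner ℝ x z = 0 := by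
  refine inner_eq_zero_of_disjoint fun j k => ?_
  by_cases h : b j = b k
  · exact Or.inr (hz j k (Or.inr h))
  · exact Or.inl (commute_realDiag_iff.1 hx j k h)

/-- The cancellation behind the block form. The form reduces to a single product of the two basis
matrices. Two factors that commute with the same diagonal matrix have a product that commutes with
it, hence is supported on its blocks, where `z` vanishes. -/
theorem shapeForm_skewBasis_eq_zero {a b : Fin N → ℝ} {z : Mat N} (hz : z ∈ normalModel a b)
    {e e' : Fin N × Fin N}
    (h : (a e.1 = a e.2 ∧ a e'.1 = a e'.2) ∨ (b e.1 = b e.2 ∧ b e'.1 = b e'.2)) :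
    shapeForm a b (skewBasis e) (skewBasis e') z = 0 := by
  by_cases ha : a e.1 = a e.2
  · rw [shapeForm_of_commute (skewBasis_mem_tangentModel (Or.inl ha))
      (skewBasis_commute_iff.2 ha)]
    rcases h with ⟨h1, h2⟩ | ⟨h1, h2⟩
    · exact inner_eq_zero_of_commute_left hz
        ((skewBasis_commute_iff.2 h1).mul_left (skewBasis_commute_iff.2 h2))
    · exact inner_eq_zero_of_commute_right hz
        ((skewBasis_commute_iff.2 h1).mul_left (skewBasis_commute_iff.2 h2))
  · rcases h with ⟨h1, h2⟩ | ⟨h1, h2⟩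
    · exact absurd h1 ha
    · rw [shapeForm_skewBasis ha h1]
      exact inner_eq_zero_of_commute_right hz
        ((skewBasis_commute_iff.2 h2).mul_left (skewBasis_commute_iff.2 h1))

/-- In either order the product is `skewBasis e * skewBasis e'`: a vector from the blocks of `a`
acts from the left, one from those of `b` only acts from the right. -/
theorem shapeForm_skewBasis_comm {a b : Fin N → ℝ} {z : Mat N} {e e' : Fin N × Fin N}
    (h : a e.1 = a e.2) (ha : a e'.1 ≠ a e'.2) (hb : b e'.1 = b e'.2) :
    shapeForm a b (skewBasis e') (skewBasis e) z =
      shapeForm a b (skewBasis e) (skewBasis e') z := by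
  rw [shapeForm_skewBasis ha hb, shapeForm_of_commute (skewBasis_mem_tangentModel (Or.inl h))
    (skewBasis_commute_iff.2 h)]

theorem inner_secondFundamentalForm {a b : Fin N → ℝ} {g h Z : Mat N} (hg : g ∈ unitarySet N)
    (hh : h ∈ unitarySet N)
    (hZ : Z ∈ normalSpace (unitarySet N) (orbit a b g h) (g * h))
    (X Y : tangentSpace (orbit a b g h) (g * h)) :
    inner ℝ (normalPart (unitarySet N) (orbit a b g h) (g * h) (frameDeriv a b g h) X Y) Z =
      shapeForm a b (gᴴ * X * hᴴ) (gᴴ * Y * hᴴ) (gᴴ * Z * hᴴ) := by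
  rw [inner_normalPart hZ, frameDeriv_apply, inner_sandwich_left hg hh, shapeForm]

/-- A normal vector is orthogonal to both basis matrices at each position inside a block, and these
two pairings determine the entry there. -/
theorem mem_normalModel {a b : Fin N → ℝ} {g h Z : Mat N} (hg : g ∈ unitarySet N)
    (hh : h ∈ unitarySet N)
    (hZ : Z ∈ normalSpace (unitarySet N) (orbit a b g h) (g * h)) :
    gᴴ * Z * hᴴ ∈ normalModel a b := by
  have h1 := (mem_tangentSpace_unitarySet (mul_mem_unitarySet hg hh)).1 hZ.1
  have h2 : gᴴ * Z * hᴴ ∈ skewModel N := by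
    rw [mem_skewModel] at *
    have h3 := congrArg (fun M => h * M * hᴴ) h1
    simpa only [conjTranspose_mul, conjTranspose_conjTranspose, mul_assoc, mul_neg, neg_mul,
      mul_conjTranspose_cancel hh, mul_conjTranspose_self hh, mul_one] using h3
  have h3 : ∀ e : Fin N × Fin N, a e.1 = a e.2 ∨ b e.1 = b e.2 →
      inner ℝ (skewBasis e) (gᴴ * Z * hᴴ) = 0 := by
    intro e he
    rw [← inner_sandwich_left hg hh]
    refine Submodule.inner_right_of_mem_orthogonal ?_ hZ.2
    rw [mem_tangentSpace_orbit hg hh]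
    simpa only [mul_assoc, conjTranspose_mul_cancel hg, mul_conjTranspose_self hh, mul_one]
      using skewBasis_mem_tangentModel he
  intro j k hjk
  exact apply_eq_zero_of_inner_skewBasis h2 (h3 (j, k) hjk)
    (h3 (k, j) (hjk.imp Eq.symm Eq.symm))

/-- If `a` and `b` have the same level sets, all shape operators vanish. -/
theorem isShapeOperator_zero {a b : Fin N → ℝ} (hab : ∀ j k, a j = a k ↔ b j = b k)
    {g h Z : Mat N} (hg : g ∈ unitarySet N) (hh : h ∈ unitarySet N)
    (hZ : Z ∈ normalSpace (unitarySet N) (orbit a b g h) (g * h)) :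
    IsShapeOperator (unitarySet N) (orbit a b g h) (g * h) Z 0 := by
  refine ⟨_, isSecondFundamentalForm_orbit a b hg hh, fun X Y => ?_⟩
  rw [inner_secondFundamentalForm hg hh hZ, LinearMap.zero_apply, inner_zero_left]
  have hX := (mem_tangentSpace_orbit hg hh).1 X.2
  have hY := (mem_tangentSpace_orbit hg hh).1 Y.2
  have hc : ∀ x ∈ tangentModel a b, Commute x (realDiag a) := fun x hx =>
    commute_realDiag_iff.2 fun j k hjk => hx.2 j k hjk fun h => hjk ((hab j k).2 h)
  rw [shapeForm_of_commute hX (hc _ hX)]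
  exact (inner_eq_zero_of_commute_left (mem_normalModel hg hh hZ)
    ((hc _ hX).mul_left (hc _ hY))).symm

section Basis

variable {a b : Fin N → ℝ} {g h : Mat N} {ι : Type*} [Fintype ι]

/-- The natural basis of the tangent space of `g U(a) U(b) h` at `g h`. -/
theorem exists_orthonormalBasis (hg : g ∈ unitarySet N) (hh : h ∈ unitarySet N)
    {f : ι → Fin N × Fin N} (hf : Function.Injective f)
    (hr : ∀ e, e ∈ Set.range f ↔ a e.1 = a e.2 ∨ b e.1 = b e.2) :
    ∃ β : OrthonormalBasis ι ℝ (tangentSpace (orbit a b g h) (g * h)),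
      ∀ i, (β i : Mat N) = g * skewBasis (f i) * h := by
  have hmem : ∀ i, g * skewBasis (f i) * h ∈ tangentSpace (orbit a b g h) (g * h) := by
    intro i
    rw [mem_tangentSpace_orbit hg hh]
    simpa only [mul_assoc, conjTranspose_mul_cancel hg, mul_conjTranspose_self hh, mul_one]
      using skewBasis_mem_tangentModel ((hr _).1 ⟨i, rfl⟩)
  let v : ι → tangentSpace (orbit a b g h) (g * h) := fun i => ⟨_, hmem i⟩
  have hv : Orthonormal ℝ v := by
    classical
    rw [orthonormal_iff_ite]
    intro i j
    rw [Submodule.coe_inner, inner_sandwich hg hh]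
    split_ifs with hij
    · rw [hij, norm_skewBasis]
    · exact inner_skewBasis_of_ne (hf.ne hij)
  -- Completeness: a tangent vector orthogonal to the family has zero entries on the blocks by the
  -- pairings, and off the blocks by tangency.
  refine ⟨OrthonormalBasis.mkOfOrthogonalEqBot hv ?_, fun i => ?_⟩
  · rw [eq_bot_iff]
    intro X hX
    rw [Submodule.mem_orthogonal] at hX
    have hXT := (mem_tangentSpace_orbit hg hh).1 X.2
    have h1 : ∀ e : Fin N × Fin N, a e.1 = a e.2 ∨ b e.1 = b e.2 →
        inner ℝ (skewBasis e) (gᴴ * X * hᴴ) = 0 := by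
      intro e he
      obtain ⟨i, rfl⟩ := (hr e).2 he
      have h2 := hX (v i) (Submodule.subset_span ⟨i, rfl⟩)
      rwa [Submodule.coe_inner, inner_sandwich_left hg hh] at h2
    have h2 : gᴴ * (X : Mat N) * hᴴ = 0 := by
      ext j k
      by_cases hjk : a j = a k ∨ b j = b k
      · exact apply_eq_zero_of_inner_skewBasis hXT.1 (h1 (j, k) hjk)
          (h1 (k, j) (hjk.imp Eq.symm Eq.symm))
      · rw [not_or] at hjk
        exact hXT.2 j k hjk.1 hjk.2
    have h3 := congrArg (fun M => g * M * h) h2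
    simp only [mul_assoc, mul_conjTranspose_cancel hg, conjTranspose_mul_self hh, mul_one,
      mul_zero, zero_mul] at h3
    exact (Submodule.mem_bot ℝ).2 (Subtype.ext h3)
  · rw [OrthonormalBasis.coe_of_orthogonal_eq_bot_mk]

theorem inner_secondFundamentalForm_basis (hg : g ∈ unitarySet N) (hh : h ∈ unitarySet N)
    {f : ι → Fin N × Fin N} {β : OrthonormalBasis ι ℝ (tangentSpace (orbit a b g h) (g * h))}
    (hβ : ∀ i, (β i : Mat N) = g * skewBasis (f i) * h) {Z : Mat N}
    (hZ : Z ∈ normalSpace (unitarySet N) (orbit a b g h) (g * h)) (i j : ι) :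
    inner ℝ (normalPart (unitarySet N) (orbit a b g h) (g * h) (frameDeriv a b g h)
      (β i) (β j)) Z =
      shapeForm a b (skewBasis (f i)) (skewBasis (f j)) (gᴴ * Z * hᴴ) := by
  rw [inner_secondFundamentalForm hg hh hZ, hβ, hβ]
  simp only [mul_assoc, conjTranspose_mul_cancel hg, mul_conjTranspose_self hh, mul_one]

end Basis

/-- The trace of the form is computed in the natural basis and paired with itself; each term
vanishes because a basis vector shares a block type with itself. -/
theorem isMinimalSubmanifold_orbit (a b : Fin N → ℝ) {g h : Mat N} (hg : g ∈ unitarySet N)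
    (hh : h ∈ unitarySet N) : IsMinimalSubmanifold (unitarySet N) (orbit a b g h) := by
  refine ⟨orbit_subset_unitarySet hg hh, isEmbeddedSubmanifold_orbit a b hg hh, ?_⟩
  rintro U ⟨u, hu, v, hv, rfl⟩
  have hg' := mul_mem_unitarySet hg hu.1
  have hh' := mul_mem_unitarySet hv.1 hh
  rw [← orbit_mul_mul hu hv, mul_assoc (g * u)]
  obtain ⟨β, hβ⟩ := exists_orthonormalBasis (a := a) (b := b) hg' hh'
    (f := fun e : {e : Fin N × Fin N // a e.1 = a e.2 ∨ b e.1 = b e.2} => (e : Fin N × Fin N))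
    Subtype.val_injective (fun e => by simp)
  refine ⟨_, isSecondFundamentalForm_orbit a b hg' hh', fun d c => ?_⟩
  rw [sum_bilinear_orthonormalBasis _ c β]
  set S := normalPart (unitarySet N) (orbit a b (g * u) (v * h)) (g * u * (v * h))
    (frameDeriv a b (g * u) (v * h)) with hS
  have hn : ∑ i, S (β i) (β i) ∈ normalSpace (unitarySet N) (orbit a b (g * u) (v * h))
      (g * u * (v * h)) :=
    Submodule.sum_mem _ fun i _ => normalPart_mem (orbit_subset_unitarySet hg' hh') _ _ _
  rw [← inner_self_eq_zero (𝕜 := ℝ), sum_inner]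
  refine Finset.sum_eq_zero fun i _ => ?_
  rw [hS, inner_secondFundamentalForm_basis hg' hh' hβ hn]
  exact shapeForm_skewBasis_eq_zero (mem_normalModel hg' hh' hn)
    (i.2.imp (fun h => ⟨h, h⟩) fun h => ⟨h, h⟩)

/-! ### Geodesics of the unitary group -/

section Geodesic

attribute [local instance] Matrix.frobeniusNormedRing Matrix.frobeniusNormedAlgebra

open NormedSpace (exp)

theorem inner_skew_hermitian {K H : Mat N} (hK : Kᴴ = -K) (hH : Hᴴ = H) :
    inner ℝ K H = 0 := by
  have h1 : inner ℝ K H = (trace (Hᴴ * K)).re := by rw [← inner_mat, real_inner_comm]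
  have h2 : inner ℝ K H = -(trace (K * H)).re := by
    rw [inner_mat, hK, neg_mul, trace_neg, Complex.neg_re]
  rw [hH, trace_mul_comm] at h1
  linarith

theorem conjTranspose_mul_deriv_mem_skewModel {γ : ℝ → Mat N} {v : Mat N} {s : ℝ}
    (hγ : HasDerivAt γ v s) (hC : ∀ᶠ t in 𝓝 s, γ t ∈ unitarySet N) :
    (γ s)ᴴ * v ∈ skewModel N := by
  have h1 : HasDerivAt (fun s => (γ s)ᴴ * γ s) (vᴴ * γ s + (γ s)ᴴ * v) s := hγ.star.mul hγ
  have h3 : (fun s => (γ s)ᴴ * γ s) =ᶠ[𝓝 s] fun _ => 1 :=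
    hC.mono fun s hs => conjTranspose_mul_self hs
  have h4 := h1.unique ((hasDerivAt_const s (1 : Mat N)).congr_of_eventuallyEq h3)
  rw [mem_skewModel, conjTranspose_mul, conjTranspose_conjTranspose]
  exact eq_neg_of_add_eq_zero_left h4

/-- Geodesics of the unitary group have constant angular velocity `γ† γ'`. -/
theorem IsGeodesicOn.conjTranspose_mul_deriv {γ : ℝ → Mat N} {ε : ℝ} (hε : 0 < ε)
    (hγ : IsGeodesicOn (unitarySet N) γ (Set.Ioo (-ε) ε)) {s : ℝ} (hs : s ∈ Set.Ioo (-ε) ε) :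
    HasDerivAt γ (γ s * ((γ 0)ᴴ * deriv γ 0)) s := by
  set I := Set.Ioo (-ε) ε
  have hI : IsOpen I := isOpen_Ioo
  have hd : ∀ s ∈ I, HasDerivAt γ (deriv γ s) s := fun s hs =>
    ((hγ.1.contDiffAt (hI.mem_nhds hs)).differentiableAt (by simp)).hasDerivAt
  have hdd : ∀ s ∈ I, HasDerivAt (deriv γ) (deriv (deriv γ) s) s := fun s hs =>
    (((hγ.1.deriv_of_isOpen (m := ∞) hI (by simp)).contDiffAt
      (hI.mem_nhds hs)).differentiableAt (by simp)).hasDerivAt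
  have hM : ∀ s ∈ I, ∀ᶠ t in 𝓝 s, γ t ∈ unitarySet N := fun s hs =>
    (hI.mem_nhds hs |> Filter.eventually_of_mem) fun t ht => (hγ.2 t ht).1
  have hsk : ∀ s ∈ I, (γ s)ᴴ * deriv γ s ∈ skewModel N := fun s hs =>
    conjTranspose_mul_deriv_mem_skewModel (hd s hs) (hM s hs)
  have hK : ∀ s ∈ I, HasDerivAt (fun s => (γ s)ᴴ * deriv γ s) 0 s := by
    intro s hs
    have h1 : HasDerivAt (fun s => (γ s)ᴴ * deriv γ s)
        ((deriv γ s)ᴴ * deriv γ s + (γ s)ᴴ * deriv (deriv γ) s) s :=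
      (hd s hs).star.mul (hdd s hs)
    -- `K` is the derivative of the skew-Hermitian `γ† γ'`, so it is skew-Hermitian. Its first
    -- summand is Hermitian, hence orthogonal to `K`; its second is `γ†` times the normal
    -- acceleration, hence also orthogonal to `K`. So `⟨K, K⟩ = 0`.
    set K := (deriv γ s)ᴴ * deriv γ s + (γ s)ᴴ * deriv (deriv γ) s with hKdef
    have hKs : K ∈ skewModel N :=
      hasDerivAt_mem_of_eventually_mem h1
        (Filter.eventually_of_mem (hI.mem_nhds hs) fun t ht => hsk t ht)
    have hU := (hγ.2 s hs).1
    have h2 : inner ℝ K ((γ s)ᴴ * deriv (deriv γ) s) = 0 := by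
      have h3 := (Submodule.starProjection_apply_eq_zero_iff _).1 (hγ.2 s hs).2
      have h4 : γ s * K * 1 ∈ tangentSpace (unitarySet N) (γ s) := by
        rwa [mul_one, mem_tangentSpace_unitarySet hU, conjTranspose_mul_cancel hU]
      have h5 := Submodule.inner_right_of_mem_orthogonal h4 h3
      rwa [inner_sandwich_left hU one_mem_unitarySet, conjTranspose_one, mul_one] at h5
    have h3 : inner ℝ K ((deriv γ s)ᴴ * deriv γ s) = 0 :=
      inner_skew_hermitian hKs (by rw [conjTranspose_mul, conjTranspose_conjTranspose])
    have h4 : K = 0 := by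
      rw [← inner_self_eq_zero (𝕜 := ℝ)]
      conv_lhs => rw [hKdef]
      rw [← hKdef, inner_add_right, h2, h3, add_zero]
    rwa [h4] at h1
  have h0 : (0 : ℝ) ∈ I := ⟨by linarith, hε⟩
  have hconst := hI.is_const_of_deriv_eq_zero isPreconnected_Ioo
    (fun s hs => (hK s hs).differentiableAt.differentiableWithinAt)
    (fun s hs => (hK s hs).deriv) hs h0
  have h1 := hd s hs
  rw [← mul_conjTranspose_cancel (hγ.2 s hs).1 (deriv γ s)] at h1
  refine h1.congr_deriv ?_
  exact congrArg (γ s * ·) hconst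

/-- With equal level sets a tangent direction `x` in the model is block diagonal for `a`, and the
geodesic `g' exp(s x) h'` moves inside `g' U(a) h'`. -/
theorem isTotallyGeodesic_orbit {a b : Fin N → ℝ} (hab : ∀ j k, a j = a k ↔ b j = b k)
    {g h : Mat N} (hg : g ∈ unitarySet N) (hh : h ∈ unitarySet N) :
    IsTotallyGeodesic (unitarySet N) (orbit a b g h) := by
  refine ⟨orbit_subset_unitarySet hg hh, isEmbeddedSubmanifold_orbit a b hg hh, ?_⟩
  rintro γ ε hε hγ ⟨u, hu, v, hv, hγ0⟩ hT
  have hg' := mul_mem_unitarySet hg hu.1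
  have hh' := mul_mem_unitarySet hv.1 hh
  rw [mul_assoc (g * u)] at hγ0
  rw [← orbit_mul_mul hu hv] at hT ⊢
  set g' := g * u
  set h' := v * h
  rw [hγ0, mem_tangentSpace_orbit hg' hh'] at hT
  have hI : ∀ s ∈ Set.Ioo (-ε) ε, HasDerivAt γ (γ s * ((γ 0)ᴴ * deriv γ 0)) s := fun s hs =>
    IsGeodesicOn.conjTranspose_mul_deriv hε hγ hs
  set x := g'ᴴ * deriv γ 0 * h'ᴴ with hx
  have hK : (γ 0)ᴴ * deriv γ 0 = h'ᴴ * x * h' := by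
    simp only [hx, hγ0, conjTranspose_mul, mul_assoc, conjTranspose_mul_self hh', mul_one]
  have hc : Commute x (realDiag a) :=
    commute_realDiag_iff.2 fun j k hjk => hT.2 j k hjk fun h => hjk ((hab j k).2 h)
  -- The geodesic solves a linear equation with constant coefficients; multiplying by `exp(-s x)`
  -- gives a constant, which identifies the solution.
  have hconst : ∀ s ∈ Set.Ioo (-ε) ε,
      HasDerivAt (fun s : ℝ => g'ᴴ * γ s * h'ᴴ * exp (s • -x)) 0 s := by
    intro s hs
    have h1 := (((hI s hs).const_mul g'ᴴ).mul_const h'ᴴ).mul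
      (hasDerivAt_exp_smul_const' (𝕂 := ℝ) (-x) s)
    refine h1.congr_deriv ?_
    simp only [hK, mul_assoc, mul_conjTranspose_self hh', mul_one, neg_mul, mul_neg,
      add_neg_cancel]
  have h0 : (0 : ℝ) ∈ Set.Ioo (-ε) ε := ⟨by linarith, hε⟩
  refine Filter.eventually_of_mem (isOpen_Ioo.mem_nhds h0) fun s hs => ?_
  have h1 := isOpen_Ioo.is_const_of_deriv_eq_zero isPreconnected_Ioo
    (fun s hs => (hconst s hs).differentiableAt.differentiableWithinAt)
    (fun s hs => (hconst s hs).deriv) hs h0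
  simp only [zero_smul, NormedSpace.exp_zero, mul_one, hγ0, mul_assoc,
    conjTranspose_mul_cancel hg', mul_conjTranspose_self hh'] at h1
  have h2 := congrArg (fun M => g' * (M * exp (s • x)) * h') h1
  have h3 : exp (s • -x) * exp (s • x) = 1 := by rw [smul_neg, exp_neg_mul_exp]
  simp only [mul_assoc, h3, mul_one, one_mul, conjTranspose_mul_self hh',
    mul_conjTranspose_cancel hg'] at h2
  refine ⟨exp (s • x), exp_mem_blockUnitary ?_ (hc.smul_left s), 1, one_mem_blockUnitary b, ?_⟩
  · have hxs : xᴴ = -x := hT.1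
    rw [conjTranspose_smul, hxs, star_trivial, smul_neg]
  · rw [h2, mul_one]
    exact (mul_assoc _ _ _).symm

end Geodesic

/-! ### The critical submanifolds as orbits -/

theorem permMat_mul_realDiag (τ : Equiv.Perm (Fin N)) (a : Fin N → ℝ) :
    permMat τ * realDiag (a ∘ τ) = realDiag a * permMat τ := by
  ext j k
  rw [mul_diagonal, diagonal_mul, permMat, of_apply]
  split_ifs with h
  · rw [h, one_mul, mul_one, Function.comp_apply]
  · rw [zero_mul, mul_zero]

theorem permMat_mem_unitarySet (τ : Equiv.Perm (Fin N)) : permMat τ ∈ unitarySet N := by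
  refine mem_unitaryGroup_iff'.2 ?_
  ext j k
  rw [star_eq_conjTranspose, mul_apply]
  simp [permMat, one_apply, τ.injective.eq_iff, eq_comm]

theorem permMat_conj_mem_blockUnitary {τ : Equiv.Perm (Fin N)} {a : Fin N → ℝ} {V : Mat N}
    (hV : V ∈ blockUnitary a) : (permMat τ)ᴴ * V * permMat τ ∈ blockUnitary (a ∘ τ) := by
  rw [mem_blockUnitary_iff] at *
  have hP := permMat_mem_unitarySet τ
  refine ⟨mul_mem_unitarySet (mul_mem_unitarySet (conjTranspose_mem_unitarySet hP) hV.1) hP, ?_⟩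
  have h1 : realDiag (a ∘ τ) * (permMat τ)ᴴ = (permMat τ)ᴴ * realDiag a := by
    have h := congrArg conjTranspose (permMat_mul_realDiag τ a)
    rwa [conjTranspose_mul, conjTranspose_mul, conjTranspose_realDiag,
      conjTranspose_realDiag] at h
  calc (permMat τ)ᴴ * V * permMat τ * realDiag (a ∘ τ)
      = (permMat τ)ᴴ * (V * realDiag a) * permMat τ := by
        simp only [mul_assoc, permMat_mul_realDiag]
    _ = realDiag (a ∘ τ) * ((permMat τ)ᴴ * V * permMat τ) := by
        rw [hV.2.eq, ← mul_assoc, ← h1]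
        simp only [mul_assoc]

theorem mul_permMat_conj_mem_blockUnitary {τ : Equiv.Perm (Fin N)} {a : Fin N → ℝ} {u : Mat N}
    (hu : u ∈ blockUnitary (a ∘ τ)) : permMat τ * u * (permMat τ)ᴴ ∈ blockUnitary a := by
  rw [mem_blockUnitary_iff] at *
  have hP := permMat_mem_unitarySet τ
  refine ⟨mul_mem_unitarySet (mul_mem_unitarySet hP hu.1) (conjTranspose_mem_unitarySet hP), ?_⟩
  have h1 : realDiag (a ∘ τ) * (permMat τ)ᴴ = (permMat τ)ᴴ * realDiag a := by
    have h := congrArg conjTranspose (permMat_mul_realDiag τ a)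
    rwa [conjTranspose_mul, conjTranspose_mul, conjTranspose_realDiag,
      conjTranspose_realDiag] at h
  calc permMat τ * u * (permMat τ)ᴴ * realDiag a
      = permMat τ * (u * realDiag (a ∘ τ)) * (permMat τ)ᴴ := by
        simp only [mul_assoc, h1]
    _ = realDiag a * (permMat τ * u * (permMat τ)ᴴ) := by
        rw [hu.2.eq, ← mul_assoc, permMat_mul_realDiag]
        simp only [mul_assoc]

/-- `P† U(m) P` is the block group of `sig ∘ τ`. Pulling `P` to the left makes the two block groups
adjacent and puts both on the same indices. -/
theorem criticalSubmanifold_eq_orbit (sig lam : Fin N → ℝ) (Γ Ω : Mat N)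
    (τ : Equiv.Perm (Fin N)) :
    criticalSubmanifold sig lam Γ Ω τ = orbit (sig ∘ τ) lam (Γᴴ * permMat τ) Ω := by
  have hP := permMat_mem_unitarySet τ
  ext U
  constructor
  · rintro ⟨V, hV, W, hW, rfl⟩
    refine ⟨_, permMat_conj_mem_blockUnitary hV, _, conjTranspose_mem_blockUnitary hW, ?_⟩
    simp only [orbitPoint, mul_assoc, mul_conjTranspose_cancel hP]
  · rintro ⟨u, hu, v, hv, rfl⟩
    refine ⟨_, mul_permMat_conj_mem_blockUnitary hu, _, conjTranspose_mem_blockUnitary hv, ?_⟩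
    simp only [orbitPoint, mul_assoc, conjTranspose_conjTranspose, conjTranspose_mul_cancel hP]

theorem criticalSubmanifold_eq_orbit_at {sig lam : Fin N → ℝ} (Γ Ω : Mat N)
    (τ : Equiv.Perm (Fin N)) {V W : Mat N} (hV : V ∈ blockUnitary sig)
    (hW : W ∈ blockUnitary lam) :
    criticalSubmanifold sig lam Γ Ω τ =
      orbit (sig ∘ τ) lam (Γᴴ * V * permMat τ) (Wᴴ * Ω) := by
  have h : Γᴴ * permMat τ * ((permMat τ)ᴴ * V * permMat τ) = Γᴴ * V * permMat τ := by
    simp only [mul_assoc, mul_conjTranspose_cancel (permMat_mem_unitarySet τ)]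
  rw [criticalSubmanifold_eq_orbit, ← orbit_mul_mul (permMat_conj_mem_blockUnitary hV)
    (conjTranspose_mem_blockUnitary hW), h]

/-! ### Block form of the shape operators -/

theorem catIndex_injective (sig lam : Fin N → ℝ) (τ : Equiv.Perm (Fin N)) :
    Function.Injective (catIndex sig lam τ) := by
  rintro ((⟨e, he⟩ | ⟨e, he⟩) | ⟨e, he⟩) ((⟨e', he'⟩ | ⟨e', he'⟩) | ⟨e', he'⟩) h <;>
    change e = e' at h <;> subst h <;>
    first
      | rfl
      | exact absurd he.1 he'.1
      | exact absurd he'.1 he.1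
      | exact absurd he.2 he'.2
      | exact absurd he'.2 he.2

theorem mem_range_catIndex {sig lam : Fin N → ℝ} {τ : Equiv.Perm (Fin N)} {e : Fin N × Fin N} :
    e ∈ Set.range (catIndex sig lam τ) ↔
      sig (τ e.1) = sig (τ e.2) ∨ lam e.1 = lam e.2 := by
  constructor
  · rintro ⟨(⟨e, he⟩ | ⟨e, he⟩) | ⟨e, he⟩, rfl⟩
    exacts [Or.inl he.1, Or.inr he.2, Or.inl he.1]
  · intro h
    by_cases h1 : sig (τ e.1) = sig (τ e.2)
    · by_cases h2 : lam e.1 = lam e.2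
      · exact ⟨Sum.inr ⟨e, h1, h2⟩, rfl⟩
      · exact ⟨Sum.inl (Sum.inl ⟨e, h1, h2⟩), rfl⟩
    · exact ⟨Sum.inl (Sum.inr ⟨e, h1, h.resolve_left h1⟩), rfl⟩

/-- Categories 1 and 3 share the blocks of `sig ∘ τ`, categories 2 and 3 those of `lam`; every
pairing other than 1 with 2 falls under the cancellation. -/
theorem exists_blockForm (sig lam : Fin N → ℝ) (τ : Equiv.Perm (Fin N)) {g h : Mat N}
    (hg : g ∈ unitarySet N) (hh : h ∈ unitarySet N) :
    ∃ b : OrthonormalBasis ((Cat1 sig lam τ ⊕ Cat2 sig lam τ) ⊕ Cat3 sig lam τ) ℝ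
        (tangentSpace (orbit (sig ∘ τ) lam g h) (g * h)),
      (∀ e, (b e : Mat N) = g * skewBasis (catIndex sig lam τ e) * h) ∧
      ∀ Z ∈ normalSpace (unitarySet N) (orbit (sig ∘ τ) lam g h) (g * h),
        ∃ A, IsShapeOperator (unitarySet N) (orbit (sig ∘ τ) lam g h) (g * h) Z A ∧
          (∃ B : Matrix (Cat1 sig lam τ) (Cat2 sig lam τ) ℝ,
            LinearMap.toMatrix b.toBasis b.toBasis A =
              fromBlocks (fromBlocks 0 B Bᵀ 0) 0 0 0) ∧
          LinearMap.trace ℝ _ A = 0 := by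
  obtain ⟨β, hβ⟩ := exists_orthonormalBasis (a := sig ∘ τ) (b := lam) hg hh
    (catIndex_injective sig lam τ) (fun _ => mem_range_catIndex)
  refine ⟨β, hβ, fun Z hZ => ?_⟩
  obtain ⟨A, hA⟩ := exists_inner_eq_bilinear (normalPart (unitarySet N)
    (orbit (sig ∘ τ) lam g h) (g * h) (frameDeriv (sig ∘ τ) lam g h)) Z
  have hz := mem_normalModel hg hh hZ
  have hM : ∀ i j, LinearMap.toMatrix β.toBasis β.toBasis A i j =
      shapeForm (sig ∘ τ) lam (skewBasis (catIndex sig lam τ j))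
        (skewBasis (catIndex sig lam τ i)) (gᴴ * Z * hᴴ) := by
    intro i j
    rw [LinearMap.toMatrix_apply, OrthonormalBasis.coe_toBasis, OrthonormalBasis.coe_toBasis_repr_apply,
      OrthonormalBasis.repr_apply_apply, real_inner_comm, hA,
      inner_secondFundamentalForm_basis hg hh hβ hZ]
  have hB : ∃ B : Matrix (Cat1 sig lam τ) (Cat2 sig lam τ) ℝ,
      LinearMap.toMatrix β.toBasis β.toBasis A =
        fromBlocks (fromBlocks 0 B Bᵀ 0) 0 0 0 := by
    -- The matrix entry at `(i, j)` pairs `j` first and `i` second. The lower block is thus `Bᵀ` by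
    -- definition, and the upper block is `B` by the symmetry of the form.
    refine ⟨of fun i j => shapeForm (sig ∘ τ) lam (skewBasis (i : Fin N × Fin N))
      (skewBasis (j : Fin N × Fin N)) (gᴴ * Z * hᴴ), ?_⟩
    ext i j
    rw [hM]
    rcases i with (i | i) | i <;> rcases j with (j | j) | j
    · exact shapeForm_skewBasis_eq_zero hz (Or.inl ⟨j.2.1, i.2.1⟩)
    · exact shapeForm_skewBasis_comm i.2.1 j.2.1 j.2.2
    · exact shapeForm_skewBasis_eq_zero hz (Or.inl ⟨j.2.1, i.2.1⟩)
    · rfl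
    · exact shapeForm_skewBasis_eq_zero hz (Or.inr ⟨j.2.2, i.2.2⟩)
    · exact shapeForm_skewBasis_eq_zero hz (Or.inr ⟨j.2.2, i.2.2⟩)
    · exact shapeForm_skewBasis_eq_zero hz (Or.inl ⟨j.2.1, i.2.1⟩)
    · exact shapeForm_skewBasis_eq_zero hz (Or.inr ⟨j.2.2, i.2.2⟩)
    · exact shapeForm_skewBasis_eq_zero hz (Or.inr ⟨j.2.2, i.2.2⟩)
  refine ⟨A, ⟨_, isSecondFundamentalForm_orbit _ _ hg hh, hA⟩, hB, ?_⟩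
  rw [LinearMap.trace_eq_matrix_trace ℝ β.toBasis]
  refine Finset.sum_eq_zero fun i _ => ?_
  rw [diag_apply, hM]
  exact shapeForm_skewBasis_eq_zero hz
    ((mem_range_catIndex.1 ⟨i, rfl⟩).imp (fun h => ⟨h, h⟩) fun h => ⟨h, h⟩)

theorem commute_conj_iff {h : Mat N} (hh : h ∈ unitarySet N) {x d : Mat N} :
    Commute (hᴴ * x * h) (hᴴ * d * h) ↔ Commute x d := by
  have h1 : ∀ x d : Mat N, hᴴ * x * h * (hᴴ * d * h) = hᴴ * (x * d) * h := fun x d => by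
    simp only [mul_assoc, mul_conjTranspose_cancel hh]
  have h2 : ∀ y z : Mat N, hᴴ * y * h = hᴴ * z * h → y = z := fun y z hyz => by
    have h3 := congrArg (fun M => h * M * hᴴ) hyz
    simpa only [mul_assoc, mul_conjTranspose_cancel hh, mul_conjTranspose_self hh, mul_one]
      using h3
  rw [commute_iff_eq, commute_iff_eq, h1, h1]
  exact ⟨fun h3 => h2 _ _ h3, fun h3 => by rw [h3]⟩

/-! ### Sizes of the blocks -/

/-- Pairs are grouped by their common value, each fibre contributing its square. Values in `t` that
are not attained contribute zero, which permits `t` to be the full product of two images in the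
contingency table. -/
theorem card_filter_eq_sum_sq {β : Type*} [DecidableEq β] {f : Fin N → β} {t : Finset β}
    (ht : ∀ j, f j ∈ t) :
    (Finset.univ.filter fun e : Fin N × Fin N => f e.1 = f e.2).card =
      ∑ x ∈ t, (Finset.univ.filter fun j => f j = x).card ^ 2 := by
  rw [Finset.card_eq_sum_card_fiberwise (f := fun e : Fin N × Fin N => f e.1) (t := t)
    fun e _ => ht e.1]
  refine Finset.sum_congr rfl fun x _ => ?_
  rw [sq, ← Finset.card_product]
  congr 1
  ext e
  simp only [Finset.mem_filter, Finset.mem_univ, true_and, Finset.mem_product]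
  exact ⟨fun h => ⟨h.2, h.1.symm.trans h.2⟩, fun h => ⟨h.1.trans h.2.symm, h.1⟩⟩

theorem sumSqMult_eq (a : Fin N → ℝ) :
    sumSqMult a = (Finset.univ.filter fun e : Fin N × Fin N => a e.1 = a e.2).card :=
  (card_filter_eq_sum_sq fun j => Finset.mem_image_of_mem a (Finset.mem_univ j)).symm

theorem sumSqMult_comp (a : Fin N → ℝ) (τ : Equiv.Perm (Fin N)) :
    sumSqMult a =
      (Finset.univ.filter fun e : Fin N × Fin N => a (τ e.1) = a (τ e.2)).card := by
  rw [sumSqMult_eq]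
  exact (Finset.card_equiv (Equiv.prodCongr τ τ) fun e => by simp).symm

theorem sumSqContingency_eq (sig lam : Fin N → ℝ) (τ : Equiv.Perm (Fin N)) :
    sumSqContingency sig lam τ = (Finset.univ.filter fun e : Fin N × Fin N =>
      sig (τ e.1) = sig (τ e.2) ∧ lam e.1 = lam e.2).card := by
  have h := card_filter_eq_sum_sq (f := fun j => (sig (τ j), lam j))
    (t := Finset.univ.image sig ×ˢ Finset.univ.image lam) fun j => Finset.mem_product.2
      ⟨Finset.mem_image_of_mem sig (Finset.mem_univ _),
        Finset.mem_image_of_mem lam (Finset.mem_univ _)⟩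
  simp only [Prod.mk.injEq, Finset.sum_product] at h
  exact h.symm

theorem card_categories (sig lam : Fin N → ℝ) (τ : Equiv.Perm (Fin N)) :
    Fintype.card (Cat1 sig lam τ) + sumSqContingency sig lam τ = sumSqMult sig ∧
    Fintype.card (Cat2 sig lam τ) + sumSqContingency sig lam τ = sumSqMult lam ∧
    Fintype.card (Cat3 sig lam τ) = sumSqContingency sig lam τ := by
  rw [sumSqContingency_eq, sumSqMult_comp sig τ, sumSqMult_eq lam, Fintype.card_subtype,
    Fintype.card_subtype, Fintype.card_subtype]
  refine ⟨?_, ?_, rfl⟩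
  · rw [← Finset.card_filter_add_card_filter_not (p := fun e : Fin N × Fin N => lam e.1 ≠ lam e.2)
      (s := Finset.univ.filter fun e : Fin N × Fin N => sig (τ e.1) = sig (τ e.2)),
      Finset.filter_filter, Finset.filter_filter]
    simp only [ne_eq, not_not]
  · rw [← Finset.card_filter_add_card_filter_not
      (p := fun e : Fin N × Fin N => sig (τ e.1) ≠ sig (τ e.2))
      (s := Finset.univ.filter fun e : Fin N × Fin N => lam e.1 = lam e.2),
      Finset.filter_filter, Finset.filter_filter]
    simp only [ne_eq, not_not, and_comm]

/-! ### Block diagonal diagonalisation -/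

theorem sum_eq_sum_subtype {a : Fin N → ℝ} {x : ℝ} {f : Fin N → ℂ}
    (hf : ∀ l, a l ≠ x → f l = 0) : ∑ l, f l = ∑ l : {l // a l = x}, f l := by
  rw [← Finset.sum_subtype (Finset.univ.filter fun l => a l = x) (by simp) f,
    Finset.sum_filter]
  refine Finset.sum_congr rfl fun l _ => ?_
  split_ifs with h
  · rfl
  · exact hf l h

/-- A Hermitian matrix that commutes with a real diagonal matrix can be diagonalised by a block
diagonal unitary matrix. -/
theorem exists_blockUnitary_diagonalize {a : Fin N → ℝ} {M : Mat N} (hM : M.IsHermitian)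
    (hc : Commute M (realDiag a)) :
    ∃ V ∈ blockUnitary a, ∃ μ : Fin N → ℝ, M * V = V * realDiag μ := by
  have hx : ∀ x : ℝ,
      (M.submatrix (Subtype.val : {j // a j = x} → Fin N) Subtype.val).IsHermitian :=
    fun x => hM.submatrix _
  let E : ∀ x : ℝ, Matrix {j // a j = x} {j // a j = x} ℂ := fun x => (hx x).eigenvectorUnitary
  -- Each diagonal block of `M` is Hermitian; its eigenvectors form a block of `V`. The block is
  -- labelled by the value at the column index, and `hV` frees the label so that sums over one block
  -- are sums over a single subtype.
  let V : Mat N := of fun j k => if h : a j = a k then E (a k) ⟨j, h⟩ ⟨k, rfl⟩ else 0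
  let μ : Fin N → ℝ := fun k => (hx (a k)).eigenvalues ⟨k, rfl⟩
  have hV : ∀ x j k (hj : a j = x) (hk : a k = x), V j k = E x ⟨j, hj⟩ ⟨k, hk⟩ := by
    intro x j k hj hk
    subst hk
    exact dif_pos hj
  have hV0 : ∀ j k, a j ≠ a k → V j k = 0 := fun j k h => dif_neg h
  have hE1 : ∀ x, (E x)ᴴ * E x = 1 := fun x => mem_unitaryGroup_iff'.1 (hx x).eigenvectorUnitary.2
  have hE2 : ∀ x, M.submatrix (Subtype.val : {j // a j = x} → Fin N) Subtype.val * E x =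
      E x * diagonal fun k => ((hx x).eigenvalues k : ℂ) := by
    intro x
    have h1 := (hx x).spectral_theorem
    rw [Unitary.conjStarAlgAut_apply] at h1
    conv_lhs => rw [h1]
    change E x * _ * (E x)ᴴ * E x = _
    rw [mul_assoc, hE1, mul_one]
    rfl
  refine ⟨V, ⟨mem_unitaryGroup_iff'.2 ?_, hV0⟩, μ, ?_⟩
  · ext j k
    rw [star_eq_conjTranspose, mul_apply]
    simp only [conjTranspose_apply]
    by_cases hjk : a j = a k
    · rw [sum_eq_sum_subtype (a := a) (x := a k) fun l hl => by rw [hV0 l k hl, mul_zero]]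
      have h1 := congrFun (congrFun (hE1 (a k)) ⟨j, hjk⟩) ⟨k, rfl⟩
      rw [mul_apply] at h1
      simp only [conjTranspose_apply] at h1
      rw [Finset.sum_congr rfl fun l _ => by rw [hV (a k) l j l.2 hjk, hV (a k) l k l.2 rfl], h1]
      simp [one_apply]
    · rw [one_apply_ne fun h : j = k => hjk (congrArg a h)]
      refine Finset.sum_eq_zero fun l _ => ?_
      by_cases hl : a l = a k
      · rw [hV0 l j fun h => hjk (h.symm.trans hl), star_zero, zero_mul]
      · rw [hV0 l k hl, mul_zero]
  · ext j k
    rw [mul_apply, mul_diagonal,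
      sum_eq_sum_subtype (a := a) (x := a k) fun l hl => by rw [hV0 l k hl, mul_zero]]
    by_cases hjk : a j = a k
    · have h1 := congrFun (congrFun (hE2 (a k)) ⟨j, hjk⟩) ⟨k, rfl⟩
      rw [mul_apply, mul_diagonal] at h1
      rw [Finset.sum_congr rfl fun l _ => by rw [hV (a k) l k l.2 rfl], hV (a k) j k hjk rfl]
      exact h1
    · rw [hV0 j k hjk, zero_mul]
      refine Finset.sum_eq_zero fun l _ => ?_
      rw [commute_realDiag_iff.1 hc j l fun h => hjk (h.trans l.2), zero_mul]

/-- Both families have the same sorted list; one sorting permutation followed by the inverse of the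
other matches them. -/
theorem exists_perm_of_multiset_eq {f g : Fin N → ℝ}
    (h : Finset.univ.val.map f = Finset.univ.val.map g) :
    ∃ τ : Equiv.Perm (Fin N), f ∘ τ = g := by
  have h1 : (List.ofFn f).Perm (List.ofFn g) := by
    rwa [Fin.univ_val_map, Fin.univ_val_map, Multiset.coe_eq_coe] at h
  have h2 : f ∘ Tuple.sort f = g ∘ Tuple.sort g :=
    List.ofFn_injective
      ((((Tuple.sort f).ofFn_comp_perm f).trans
        (h1.trans ((Tuple.sort g).ofFn_comp_perm g).symm)).eq_of_pairwise'
        (Tuple.monotone_sort f).sortedLE_ofFn.pairwise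
        (Tuple.monotone_sort g).sortedLE_ofFn.pairwise)
  refine ⟨(Tuple.sort g).symm.trans (Tuple.sort f), funext fun k => ?_⟩
  have h3 := congrFun h2 ((Tuple.sort g).symm k)
  simpa using h3

/-- Unitarily equivalent diagonal matrices have the same entries, up to a permutation. -/
theorem exists_perm_of_mul_eq {lam μ : Fin N → ℝ} {Q : Mat N} (hQ : Q ∈ unitarySet N)
    (h : Q * realDiag lam = realDiag μ * Q) : ∃ τ : Equiv.Perm (Fin N), μ ∘ τ = lam := by
  have h1 : (realDiag μ).charpoly = (realDiag lam).charpoly := by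
    have h2 : realDiag μ = Q * realDiag lam * Qᴴ := by
      rw [h, mul_assoc, mul_conjTranspose_self hQ, mul_one]
    rw [h2, charpoly_mul_comm, conjTranspose_mul_cancel hQ]
  have h3 : ∀ f : Fin N → ℝ, (realDiag f).charpoly.roots =
      (Finset.univ.val.map f).map ((↑) : ℝ → ℂ) := by
    intro f
    rw [charpoly_diagonal, Multiset.map_map]
    have h4 := Polynomial.roots_multiset_prod_X_sub_C
      (Finset.univ.val.map fun i => (f i : ℂ))
    rw [Multiset.map_map] at h4
    exact h4
  have h4 := congrArg Polynomial.roots h1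
  rw [h3, h3] at h4
  exact exists_perm_of_multiset_eq (Multiset.map_injective Complex.ofReal_injective h4)

/-! ### The critical points of the landscape -/

section Critical

attribute [local instance] Matrix.frobeniusNormedRing Matrix.frobeniusNormedAlgebra

/-- The real part of the trace, as a continuous linear map. -/
def reTrace (N : ℕ) : Mat N →L[ℝ] ℝ :=
  LinearMap.toContinuousLinearMap (Complex.reLm.comp (traceLinearMap (Fin N) ℝ ℂ))

theorem differentiable_landscape (ρ O : Mat N) : Differentiable ℝ (landscape ρ O) := by
  have h : Differentiable ℝ fun U : Mat N => U * ρ * Uᴴ * O :=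
    ((differentiable_id.mul_const ρ).mul differentiable_id.star).mul_const O
  exact (reTrace N).differentiable.comp h

/-- Along `K U` the matrix `U ρ U†` varies by its commutator with `K`; cyclicity of the trace moves
the commutator onto `O`. -/
theorem fderiv_landscape (ρ O U : Mat N) {K : Mat N} (hK : K ∈ skewModel N) :
    fderiv ℝ (landscape ρ O) U (K * U) =
      -inner ℝ K (U * ρ * Uᴴ * O - O * (U * ρ * Uᴴ)) := by
  have h1 := hasDerivAt_comp_add_smul (differentiable_landscape ρ O U).hasFDerivAt (K * U)
  have hc := hasDerivAt_add_smul U (K * U)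
  have h2 : HasDerivAt (fun s : ℝ => (U + s • (K * U)) * ρ * (U + s • (K * U))ᴴ * O)
      ((K * U * ρ * Uᴴ + U * ρ * (K * U)ᴴ) * O) 0 := by
    have h := ((hc.mul_const ρ).mul hc.star).mul_const O
    simp only [zero_smul, add_zero] at h
    exact h
  have h3 : HasDerivAt (fun s : ℝ => landscape ρ O (U + s • (K * U)))
      (reTrace N ((K * U * ρ * Uᴴ + U * ρ * (K * U)ᴴ) * O)) 0 :=
    (reTrace N).hasFDerivAt.comp_hasDerivAt 0 h2
  refine (h1.unique h3).trans ?_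
  change (trace ((K * U * ρ * Uᴴ + U * ρ * (K * U)ᴴ) * O)).re = _
  rw [inner_mat, mem_skewModel.1 hK, neg_mul, trace_neg, Complex.neg_re, neg_neg]
  congr 1
  have h4 : trace (K * (O * (U * ρ * Uᴴ))) = trace (U * ρ * Uᴴ * K * O) := by
    rw [← mul_assoc K, trace_mul_comm, ← mul_assoc _ K]
  rw [mul_sub, trace_sub, h4, add_mul, trace_add, conjTranspose_mul, mem_skewModel.1 hK]
  simp only [mul_assoc, mul_neg, neg_mul, trace_neg, sub_eq_add_neg]

/-- The commutator of two Hermitian matrices is skew-Hermitian, so it is itself an admissible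
direction; at a critical point its norm must vanish. -/
theorem mem_criticalSet_iff {ρ O : Mat N} (hρ : ρ.IsHermitian) (hO : O.IsHermitian) {U : Mat N} :
    U ∈ criticalSet ρ O ↔ U ∈ unitarySet N ∧ Commute (U * ρ * Uᴴ) O := by
  refine and_congr_right fun hU => ⟨fun h => ?_, fun h X hX => ?_⟩
  · set C := U * ρ * Uᴴ * O - O * (U * ρ * Uᴴ) with hC
    have hCs : C ∈ skewModel N := by
      rw [mem_skewModel, hC]
      simp only [conjTranspose_sub, conjTranspose_mul, conjTranspose_conjTranspose, hρ.eq, hO.eq,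
        mul_assoc, neg_sub]
    have hT : C * U ∈ tangentSpace (unitarySet N) U := by
      rw [mem_tangentSpace_unitarySet hU, mem_skewModel]
      simp only [conjTranspose_mul, conjTranspose_conjTranspose, mem_skewModel.1 hCs, mul_neg,
        neg_mul, mul_assoc]
    have h1 := (fderiv_landscape ρ O U hCs).symm.trans (h _ hT)
    rw [neg_eq_zero, ← hC] at h1
    exact sub_eq_zero.1 (inner_self_eq_zero.1 h1)
  · rw [mem_tangentSpace_unitarySet hU, mem_skewModel, conjTranspose_mul,
      conjTranspose_conjTranspose] at hX
    have hK : X * Uᴴ ∈ skewModel N := by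
      have h1 := congrArg (fun M => U * M * Uᴴ) hX
      simp only [mul_assoc, mul_conjTranspose_self hU, mul_one, mul_neg, neg_mul,
        mul_conjTranspose_cancel hU] at h1
      rw [mem_skewModel, conjTranspose_mul, conjTranspose_conjTranspose, h1]
    have h1 := fderiv_landscape ρ O U hK
    rw [mul_assoc, conjTranspose_mul_self hU, mul_one, sub_eq_zero.2 h.eq, inner_zero_right,
      neg_zero] at h1
    exact h1

end Critical

/-- The observable in the frame of a point of a critical submanifold. -/
theorem conj_observable {sig : Fin N → ℝ} {O Γ V : Mat N} (τ : Equiv.Perm (Fin N))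
    (hΓO : Γ * O * Γᴴ = realDiag sig) (hV : V ∈ blockUnitary sig) :
    (Γᴴ * V * permMat τ)ᴴ * O * (Γᴴ * V * permMat τ) = realDiag (sig ∘ τ) := by
  have hP := permMat_mem_unitarySet τ
  have h1 : Vᴴ * realDiag sig * V = realDiag sig := by
    rw [mul_assoc, ← (mem_blockUnitary_iff.1 hV).2.eq, conjTranspose_mul_cancel hV.1]
  calc (Γᴴ * V * permMat τ)ᴴ * O * (Γᴴ * V * permMat τ)
      = (permMat τ)ᴴ * (Vᴴ * (Γ * O * Γᴴ) * V) * permMat τ := by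
        simp only [conjTranspose_mul, conjTranspose_conjTranspose, mul_assoc]
    _ = realDiag (sig ∘ τ) := by
        rw [hΓO, h1, mul_assoc, ← permMat_mul_realDiag, conjTranspose_mul_cancel hP]

theorem eq_conj_of_conj_eq {Ω ρ D : Mat N} (hΩ : Ω ∈ unitarySet N) (h : Ω * ρ * Ωᴴ = D) :
    ρ = Ωᴴ * D * Ω := by
  rw [← h]
  simp only [mul_assoc, conjTranspose_mul_self hΩ, mul_one, conjTranspose_mul_cancel hΩ]

/-- For critical `U` and `Q = Γ U Ω†`, the matrix `Q diag(lam) Q†` commutes with `diag sig`, so some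
`V` in `U(m)` diagonalises it. Then `V† Q` intertwines `diag lam` with a rearrangement of it, and
correcting by the permutation matrix leaves a matrix commuting with `diag lam`, that is, an element
of `U(n)`. -/
theorem criticalSet_eq {ρ O : Mat N} (hρ : ρ.IsHermitian) (hO : O.IsHermitian)
    {lam sig : Fin N → ℝ} {Ω Γ : Mat N} (hΩ : Ω ∈ unitarySet N) (hΓ : Γ ∈ unitarySet N)
    (hΩρ : Ω * ρ * Ωᴴ = realDiag lam) (hΓO : Γ * O * Γᴴ = realDiag sig) :
    criticalSet ρ O = ⋃ τ : Equiv.Perm (Fin N), criticalSubmanifold sig lam Γ Ω τ := by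
  ext U
  rw [mem_criticalSet_iff hρ hO, Set.mem_iUnion]
  constructor
  · rintro ⟨hU, hc⟩
    set Q := Γ * U * Ωᴴ with hQ
    have hQu : Q ∈ unitarySet N :=
      mul_mem_unitarySet (mul_mem_unitarySet hΓ hU) (conjTranspose_mem_unitarySet hΩ)
    have hR : Γ * (U * ρ * Uᴴ) * Γᴴ = Q * realDiag lam * Qᴴ := by
      rw [hQ, eq_conj_of_conj_eq hΩ hΩρ]
      simp only [conjTranspose_mul, conjTranspose_conjTranspose, mul_assoc]
    have hM : (Q * realDiag lam * Qᴴ).IsHermitian :=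
      isHermitian_mul_mul_conjTranspose Q (conjTranspose_realDiag lam)
    have hc' : Commute (Q * realDiag lam * Qᴴ) (realDiag sig) := by
      rw [← hR, ← hΓO]
      have h1 := (commute_conj_iff (conjTranspose_mem_unitarySet hΓ)).2 hc
      rwa [conjTranspose_conjTranspose] at h1
    obtain ⟨V, hV, μ, hVμ⟩ := exists_blockUnitary_diagonalize hM hc'
    have h1 : Vᴴ * Q * realDiag lam = realDiag μ * (Vᴴ * Q) := by
      have h2 := congrArg (fun M => Vᴴ * (M * (Vᴴ * Q))) hVμ
      simp only [mul_assoc, conjTranspose_mul_cancel hV.1, mul_conjTranspose_cancel hV.1,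
        conjTranspose_mul_self hQu, mul_one] at h2
      rw [mul_assoc]
      exact h2
    obtain ⟨τ, hτ⟩ := exists_perm_of_mul_eq
      (mul_mem_unitarySet (conjTranspose_mem_unitarySet hV.1) hQu) h1
    have hP := permMat_mem_unitarySet τ
    have h2 : realDiag lam * (permMat τ)ᴴ = (permMat τ)ᴴ * realDiag μ := by
      have h := congrArg conjTranspose (permMat_mul_realDiag τ μ)
      rwa [hτ, conjTranspose_mul, conjTranspose_mul, conjTranspose_realDiag,
        conjTranspose_realDiag] at h
    have hR : (permMat τ)ᴴ * (Vᴴ * Q) ∈ blockUnitary lam := by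
      refine mem_blockUnitary_iff.2 ⟨mul_mem_unitarySet (conjTranspose_mem_unitarySet hP)
        (mul_mem_unitarySet (conjTranspose_mem_unitarySet hV.1) hQu), ?_⟩
      rw [commute_iff_eq, mul_assoc, h1, ← mul_assoc, ← h2, mul_assoc]
    refine ⟨τ, V, hV, _, conjTranspose_mem_blockUnitary hR, ?_⟩
    simp only [orbitPoint, conjTranspose_conjTranspose, mul_assoc, mul_conjTranspose_cancel hP,
      mul_conjTranspose_cancel hV.1, hQ, conjTranspose_mul_cancel hΓ,
      conjTranspose_mul_self hΩ, mul_one]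
  · rintro ⟨τ, hUτ⟩
    rw [criticalSubmanifold_eq_orbit] at hUτ
    have hg : Γᴴ * permMat τ ∈ unitarySet N :=
      mul_mem_unitarySet (conjTranspose_mem_unitarySet hΓ) (permMat_mem_unitarySet τ)
    refine ⟨orbit_subset_unitarySet hg hΩ hUτ, ?_⟩
    obtain ⟨u, hu, v, hv, rfl⟩ := hUτ
    set g := Γᴴ * permMat τ with hgdef
    have hO' : gᴴ * O * g = realDiag (sig ∘ τ) := by
      have h := conj_observable τ hΓO (one_mem_blockUnitary sig)
      rwa [mul_one] at h
    rw [← commute_conj_iff hg, hO']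
    have h1 : gᴴ * (g * u * v * Ω * ρ * (g * u * v * Ω)ᴴ) * g =
        u * v * (Ω * ρ * Ωᴴ) * (u * v)ᴴ := by
      simp only [conjTranspose_mul, mul_assoc, conjTranspose_mul_cancel hg,
        conjTranspose_mul_self hg, mul_one]
    rw [h1, hΩρ]
    exact commute_conj_of_mem_blockUnitary hu hv

/-! ### Transition probabilities -/

/-- The eigenvalues of a projection of trace one are a single 1 and zeros; the ordering puts the 1
at the first index. -/
theorem exists_eq_ite_of_antitone {lam : Fin N → ℝ} (hlam : Antitone lam)
    (h01 : ∀ j, lam j * lam j = lam j) (hsum : ∑ j, lam j = 1) :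
    ∃ z : Fin N, (z : ℕ) = 0 ∧ ∀ j, lam j = if j = z then 1 else 0 := by
  have hN : 0 < N := by
    rcases Nat.eq_zero_or_pos N with rfl | h
    · simp at hsum
    · exact h
  have hv : ∀ j, lam j = 0 ∨ lam j = 1 := fun j => by
    rcases mul_eq_zero.1 (show lam j * (lam j - 1) = 0 by linear_combination h01 j) with h | h
    · exact Or.inl h
    · exact Or.inr (sub_eq_zero.1 h)
  have h0 : ∀ j, 0 ≤ lam j := fun j => by rcases hv j with h | h <;> rw [h]; exact zero_le_one
  refine ⟨⟨0, hN⟩, rfl, ?_⟩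
  set z : Fin N := ⟨0, hN⟩
  have hz : lam z = 1 := by
    refine (hv z).resolve_left fun hz => ?_
    have h1 : ∀ j, lam j = 0 := fun j =>
      le_antisymm (hz ▸ hlam (Fin.mk_le_of_le_val (Nat.zero_le j))) (h0 j)
    simp [h1] at hsum
  rw [← Finset.add_sum_erase _ _ (Finset.mem_univ z), hz, add_eq_left,
    Finset.sum_eq_zero_iff_of_nonneg fun j _ => h0 j] at hsum
  intro j
  split_ifs with h
  · rw [h, hz]
  · exact hsum j (Finset.mem_erase.2 ⟨h, Finset.mem_univ j⟩)

open scoped ComplexOrder in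
theorem star_dotProduct_self_ne_zero {v : Fin N → ℂ} (hv : v ≠ 0) : star v ⬝ᵥ v ≠ 0 :=
  fun h => hv (dotProduct_star_self_eq_zero.1 h)

theorem rankOneProj_mul_self {v : Fin N → ℂ} (hv : v ≠ 0) :
    rankOneProj v * rankOneProj v = rankOneProj v := by
  have h : star v ⬝ᵥ v ≠ 0 := star_dotProduct_self_ne_zero hv
  rw [rankOneProj, smul_mul_smul_comm, vecMulVec_mul_vecMulVec, vecMulVec_smul, smul_smul]
  congr 1
  field_simp

theorem trace_rankOneProj {v : Fin N → ℂ} (hv : v ≠ 0) : trace (rankOneProj v) = 1 := by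
  have h : star v ⬝ᵥ v ≠ 0 := star_dotProduct_self_ne_zero hv
  rw [rankOneProj, trace_smul, trace_vecMulVec, dotProduct_comm v, smul_eq_mul, inv_mul_cancel₀ h]

theorem eigenvalues_rankOneProj {v : Fin N → ℂ} (hv : v ≠ 0) {lam : Fin N → ℝ}
    (hlam : Antitone lam) {Ω : Mat N} (hΩ : Ω ∈ unitarySet N)
    (h : Ω * rankOneProj v * Ωᴴ = realDiag lam) :
    ∃ z : Fin N, (z : ℕ) = 0 ∧ ∀ j, lam j = if j = z then 1 else 0 := by
  refine exists_eq_ite_of_antitone hlam (fun j => ?_) ?_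
  · have h1 : realDiag lam * realDiag lam = realDiag lam := by
      rw [← h]
      conv_rhs => rw [← rankOneProj_mul_self hv]
      simp only [mul_assoc, conjTranspose_mul_cancel hΩ]
    have h2 := congrFun (congrFun h1 j) j
    rw [diagonal_mul, realDiag_apply, if_pos rfl] at h2
    exact_mod_cast h2
  · have h1 : trace (realDiag lam) = 1 := by
      rw [← h, trace_mul_comm, conjTranspose_mul_cancel hΩ, trace_rankOneProj hv]
    rw [trace_diagonal] at h1
    exact_mod_cast h1

/-- Row `z` and column `z` of a unitary matrix have norm one, so a corner entry of modulus one
forces their other entries to vanish, and conversely. -/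
theorem mem_blockUnitary_iff_norm {d : Fin N → ℝ} {z : Fin N}
    (hd : ∀ j, d j = if j = z then 1 else 0) {Q : Mat N} (hQ : Q ∈ unitarySet N) :
    Q ∈ blockUnitary d ↔ Complex.normSq (Q z z) = 1 := by
  have hrow : Complex.normSq (Q z z) + ∑ k ∈ Finset.univ.erase z, Complex.normSq (Q z k) = 1 := by
    rw [Finset.add_sum_erase _ (fun k => Complex.normSq (Q z k)) (Finset.mem_univ z)]
    have h1 := congrFun (congrFun (mul_conjTranspose_self hQ) z) z
    rw [mul_apply, one_apply_eq] at h1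
    simp only [conjTranspose_apply, Complex.star_def, Complex.mul_conj] at h1
    exact_mod_cast h1
  have hcol : Complex.normSq (Q z z) + ∑ k ∈ Finset.univ.erase z, Complex.normSq (Q k z) = 1 := by
    rw [Finset.add_sum_erase _ (fun k => Complex.normSq (Q k z)) (Finset.mem_univ z)]
    have h1 := congrFun (congrFun (conjTranspose_mul_self hQ) z) z
    rw [mul_apply, one_apply_eq] at h1
    simp only [conjTranspose_apply, Complex.star_def, mul_comm _ (Q _ _), Complex.mul_conj] at h1
    exact_mod_cast h1
  constructor
  · intro h
    rw [Finset.sum_eq_zero, add_zero] at hrow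
    · exact hrow
    · intro k hk
      rw [h.2 z k, map_zero]
      rw [hd, hd, if_pos rfl, if_neg (Finset.ne_of_mem_erase hk)]
      exact one_ne_zero
  · intro h
    rw [h, add_eq_left, Finset.sum_eq_zero_iff_of_nonneg fun k _ => Complex.normSq_nonneg _]
      at hrow hcol
    refine ⟨hQ, fun j k hjk => ?_⟩
    rw [hd, hd] at hjk
    by_cases hj : j = z
    · subst hj
      have hk : k ≠ j := fun hk => hjk (by rw [hk])
      exact Complex.normSq_eq_zero.1 (hrow k (Finset.mem_erase.2 ⟨hk, Finset.mem_univ k⟩))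
    · by_cases hk : k = z
      · subst hk
        exact Complex.normSq_eq_zero.1 (hcol j (Finset.mem_erase.2 ⟨hj, Finset.mem_univ j⟩))
      · rw [if_neg hj, if_neg hk] at hjk
        exact absurd rfl hjk

theorem permMat_one : permMat (1 : Equiv.Perm (Fin N)) = 1 := by
  ext j k
  rw [one_apply]
  rfl

theorem landscape_of_projections {ρ O Ω Γ U : Mat N} {d : Fin N → ℝ} {z : Fin N}
    (hd : ∀ j, d j = if j = z then 1 else 0) (hΩ : Ω ∈ unitarySet N) (hΓ : Γ ∈ unitarySet N)
    (hΩρ : Ω * ρ * Ωᴴ = realDiag d) (hΓO : Γ * O * Γᴴ = realDiag d) :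
    landscape ρ O U = Complex.normSq ((Γ * U * Ωᴴ) z z) := by
  set Q := Γ * U * Ωᴴ with hQ
  have hD : realDiag d = single z z 1 := by
    ext j k
    rw [realDiag_apply, single_apply, hd]
    by_cases hjk : j = k
    · subst hjk
      by_cases hj : j = z
      · simp [hj]
      · simp [hj, Ne.symm hj]
    · rw [if_neg hjk, if_neg fun h => hjk (h.1.symm.trans h.2)]
  have h1 : trace (U * ρ * Uᴴ * O) = trace (Q * realDiag d * Qᴴ * realDiag d) := by
    rw [eq_conj_of_conj_eq hΩ hΩρ, eq_conj_of_conj_eq hΓ hΓO, ← mul_assoc, trace_mul_comm]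
    simp only [hQ, conjTranspose_mul, conjTranspose_conjTranspose, mul_assoc]
  have h2 : trace (Q * realDiag d * Qᴴ * realDiag d) = Q z z * star (Q z z) := by
    rw [hD, trace_mul_comm, trace_single_mul, smul_eq_mul, one_mul, mul_apply,
      Finset.sum_eq_single z]
    · simp
    · intro k _ hk
      rw [mul_single_apply_of_ne _ _ _ _ _ hk, zero_mul]
    · simp
  rw [landscape, h1, h2, Complex.star_def, Complex.mul_conj, Complex.ofReal_re]

/-- Entries of a unitary matrix have modulus at most 1, and `Γ† Ω` attains the value 1. The maximum
set is then cut out by `|Q z z| = 1`, which says that `Q` is block diagonal. -/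
theorem maximumSet_eq {ρ O Ω Γ : Mat N} {d : Fin N → ℝ} {z : Fin N}
    (hd : ∀ j, d j = if j = z then 1 else 0) (hΩ : Ω ∈ unitarySet N) (hΓ : Γ ∈ unitarySet N)
    (hΩρ : Ω * ρ * Ωᴴ = realDiag d) (hΓO : Γ * O * Γᴴ = realDiag d) :
    maximumSet ρ O = criticalSubmanifold d d Γ Ω 1 := by
  have hJ := fun U => landscape_of_projections (U := U) hd hΩ hΓ hΩρ hΓO
  have hQ : ∀ U ∈ unitarySet N, Γ * U * Ωᴴ ∈ unitarySet N := fun U hU =>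
    mul_mem_unitarySet (mul_mem_unitarySet hΓ hU) (conjTranspose_mem_unitarySet hΩ)
  have hle : ∀ U ∈ unitarySet N, landscape ρ O U ≤ 1 := fun U hU => by
    rw [hJ, Complex.normSq_eq_norm_sq]
    exact pow_le_one₀ (norm_nonneg _) (entry_norm_bound_of_unitary (hQ U hU) z z)
  have hmax : ∀ U, U ∈ maximumSet ρ O ↔ U ∈ unitarySet N ∧ landscape ρ O U = 1 := by
    intro U
    refine and_congr_right fun hU => ⟨fun h => le_antisymm (hle U hU) ?_, fun h V hV => ?_⟩
    · have h1 := h _ (mul_mem_unitarySet (conjTranspose_mem_unitarySet hΓ) hΩ)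
      rwa [hJ (Γᴴ * Ω), mul_conjTranspose_cancel hΓ, mul_conjTranspose_self hΩ, one_apply_eq,
        map_one] at h1
    · rw [h]
      exact hle V hV
  rw [criticalSubmanifold_eq_orbit, permMat_one, mul_one]
  ext U
  rw [hmax]
  constructor
  · rintro ⟨hU, h⟩
    rw [hJ, ← mem_blockUnitary_iff_norm hd (hQ U hU)] at h
    refine ⟨_, h, 1, one_mem_blockUnitary d, ?_⟩
    simp only [mul_assoc, conjTranspose_mul_self hΩ, mul_one, conjTranspose_mul_cancel hΓ]
  · intro hUo
    have hU := orbit_subset_unitarySet (conjTranspose_mem_unitarySet hΓ) hΩ hUo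
    refine ⟨hU, ?_⟩
    rw [hJ, ← mem_blockUnitary_iff_norm hd (hQ U hU)]
    obtain ⟨u, hu, v, hv, rfl⟩ := hUo
    have h1 : Γ * (Γᴴ * u * v * Ω) * Ωᴴ = u * v := by
      simp only [mul_assoc, mul_conjTranspose_cancel hΓ, mul_conjTranspose_self hΩ, mul_one]
    rw [h1]
    exact mul_mem_blockUnitary hu hv

end Landscape

end

/-! ### The theorem on the critical submanifolds of the landscape. -/

theorem mainTheorem5 (N : ℕ) (ρ O : Landscape.Mat N)
    (hρ : ρ.IsHermitian) (hO : O.IsHermitian)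
    (lam sig : Fin N → ℝ) (hlam : Antitone lam) (hsig : Antitone sig)
    (Ω Γ : Landscape.Mat N)
    (hΩ : Ω ∈ Landscape.unitarySet N) (hΓ : Γ ∈ Landscape.unitarySet N)
    (hΩρ : Ω * ρ * Ω.conjTranspose = Matrix.diagonal (fun j => (lam j : ℂ)))
    (hΓO : Γ * O * Γ.conjTranspose = Matrix.diagonal (fun j => (sig j : ℂ))) :
    -- the critical submanifolds fill the critical set of the landscape
    (Landscape.criticalSet ρ O =
      ⋃ τ : Equiv.Perm (Fin N), Landscape.criticalSubmanifold sig lam Γ Ω τ) ∧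
    -- block form of the shape operators in the natural basis, and vanishing trace
    (∀ (τ : Equiv.Perm (Fin N)),
      ∀ V ∈ Landscape.blockUnitary sig, ∀ W ∈ Landscape.blockUnitary lam,
      ∀ U : Landscape.Mat N, U = Landscape.orbitPoint Γ Ω τ V W →
      (∀ e : Fin N × Fin N,
        (Commute (U.conjTranspose * Landscape.naturalVector Γ Ω τ V W e)
            (U.conjTranspose * O * U) ↔ sig (τ e.1) = sig (τ e.2)) ∧
        (Commute (U.conjTranspose * Landscape.naturalVector Γ Ω τ V W e) ρ ↔
          lam e.1 = lam e.2)) ∧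
      ∃ b : OrthonormalBasis
          ((Landscape.Cat1 sig lam τ ⊕ Landscape.Cat2 sig lam τ) ⊕ Landscape.Cat3 sig lam τ) ℝ
          (Landscape.tangentSpace (Landscape.criticalSubmanifold sig lam Γ Ω τ) U),
        (∀ e, (b e : Landscape.Mat N) =
          Landscape.naturalVector Γ Ω τ V W (Landscape.catIndex sig lam τ e)) ∧
        ∀ Z ∈ Landscape.normalSpace (Landscape.unitarySet N)
            (Landscape.criticalSubmanifold sig lam Γ Ω τ) U,
          ∃ A, Landscape.IsShapeOperator (Landscape.unitarySet N)
              (Landscape.criticalSubmanifold sig lam Γ Ω τ) U Z A ∧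
            (∃ B : Matrix (Landscape.Cat1 sig lam τ) (Landscape.Cat2 sig lam τ) ℝ,
              LinearMap.toMatrix b.toBasis b.toBasis A =
                Matrix.fromBlocks (Matrix.fromBlocks 0 B B.transpose 0) 0 0 0) ∧
            LinearMap.trace ℝ _ A = 0) ∧
    -- sizes of the blocks
    (∀ τ : Equiv.Perm (Fin N),
      Fintype.card (Landscape.Cat1 sig lam τ) + Landscape.sumSqContingency sig lam τ =
        Landscape.sumSqMult sig ∧
      Fintype.card (Landscape.Cat2 sig lam τ) + Landscape.sumSqContingency sig lam τ =
        Landscape.sumSqMult lam ∧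
      Fintype.card (Landscape.Cat3 sig lam τ) = Landscape.sumSqContingency sig lam τ) ∧
    -- every critical submanifold is minimal
    (∀ τ : Equiv.Perm (Fin N),
      Landscape.IsMinimalSubmanifold (Landscape.unitarySet N)
        (Landscape.criticalSubmanifold sig lam Γ Ω τ)) ∧
    -- fully non-degenerate case
    (Function.Injective lam → Function.Injective sig → ∀ τ : Equiv.Perm (Fin N),
      Landscape.IsTotallyGeodesic (Landscape.unitarySet N)
        (Landscape.criticalSubmanifold sig lam Γ Ω τ) ∧
      ∀ U ∈ Landscape.criticalSubmanifold sig lam Γ Ω τ,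
        ∀ Z ∈ Landscape.normalSpace (Landscape.unitarySet N)
          (Landscape.criticalSubmanifold sig lam Γ Ω τ) U,
        Landscape.IsShapeOperator (Landscape.unitarySet N)
          (Landscape.criticalSubmanifold sig lam Γ Ω τ) U Z 0) ∧
    -- maximum of the transition probability from `i` to `f`
    (∀ i f : Fin N → ℂ, i ≠ 0 → f ≠ 0 →
      ρ = Landscape.rankOneProj i → O = Landscape.rankOneProj f →
      Landscape.maximumSet ρ O = Landscape.criticalSubmanifold sig lam Γ Ω 1 ∧
      Landscape.IsTotallyGeodesic (Landscape.unitarySet N) (Landscape.maximumSet ρ O) ∧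
      ∀ U ∈ Landscape.maximumSet ρ O,
        ∀ Z ∈ Landscape.normalSpace (Landscape.unitarySet N) (Landscape.maximumSet ρ O) U,
        Landscape.IsShapeOperator (Landscape.unitarySet N) (Landscape.maximumSet ρ O) U Z 0) := by
  have hg : ∀ (τ : Equiv.Perm (Fin N)) {V : Landscape.Mat N}, V ∈ Landscape.blockUnitary sig →
      Γ.conjTranspose * V * Landscape.permMat τ ∈ Landscape.unitarySet N := fun τ V hV =>
    Landscape.mul_mem_unitarySet (Landscape.mul_mem_unitarySet
      (Landscape.conjTranspose_mem_unitarySet hΓ) hV.1)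
      (Landscape.permMat_mem_unitarySet τ)
  have hh : ∀ {W : Landscape.Mat N}, W ∈ Landscape.blockUnitary lam →
      W.conjTranspose * Ω ∈ Landscape.unitarySet N := fun hW =>
    Landscape.mul_mem_unitarySet (Landscape.conjTranspose_mem_unitarySet hW.1) hΩ
  have hpt : ∀ (τ : Equiv.Perm (Fin N)) (V W X : Landscape.Mat N),
      Γ.conjTranspose * V * Landscape.permMat τ * X * W.conjTranspose * Ω =
        Γ.conjTranspose * V * Landscape.permMat τ * X * (W.conjTranspose * Ω) :=
    fun τ V W X => mul_assoc _ _ _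
  have hpt' : ∀ (τ : Equiv.Perm (Fin N)) (V W : Landscape.Mat N),
      Landscape.orbitPoint Γ Ω τ V W =
        Γ.conjTranspose * V * Landscape.permMat τ * (W.conjTranspose * Ω) :=
    fun τ V W => mul_assoc _ _ _
  -- Common source of both totally geodesic cases: `sig ∘ τ` and `lam` have the same level sets.
  have hsame : ∀ τ : Equiv.Perm (Fin N),
      (∀ j k, (sig ∘ τ) j = (sig ∘ τ) k ↔ lam j = lam k) →
      Landscape.IsTotallyGeodesic (Landscape.unitarySet N)
        (Landscape.criticalSubmanifold sig lam Γ Ω τ) ∧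
      ∀ U ∈ Landscape.criticalSubmanifold sig lam Γ Ω τ,
        ∀ Z ∈ Landscape.normalSpace (Landscape.unitarySet N)
          (Landscape.criticalSubmanifold sig lam Γ Ω τ) U,
        Landscape.IsShapeOperator (Landscape.unitarySet N)
          (Landscape.criticalSubmanifold sig lam Γ Ω τ) U Z 0 := by
    intro τ hab
    refine ⟨?_, ?_⟩
    · rw [Landscape.criticalSubmanifold_eq_orbit]
      exact Landscape.isTotallyGeodesic_orbit hab (Landscape.mul_mem_unitarySet
        (Landscape.conjTranspose_mem_unitarySet hΓ) (Landscape.permMat_mem_unitarySet τ)) hΩ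
    · rintro U ⟨V, hV, W, hW, rfl⟩ Z
      rw [Landscape.criticalSubmanifold_eq_orbit_at Γ Ω τ hV hW, hpt']
      exact fun hZ => Landscape.isShapeOperator_zero hab (hg τ hV) (hh hW) hZ
  refine ⟨Landscape.criticalSet_eq hρ hO hΩ hΓ hΩρ hΓO, ?_, Landscape.card_categories sig lam,
    ?_, ?_, ?_⟩
  · rintro τ V hV W hW U rfl
    refine ⟨fun e => ?_, ?_⟩
    · have h1 : (Landscape.orbitPoint Γ Ω τ V W).conjTranspose *
          Landscape.naturalVector Γ Ω τ V W e =
          (W.conjTranspose * Ω).conjTranspose * Landscape.skewBasis e *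
            (W.conjTranspose * Ω) := by
        rw [hpt', Landscape.naturalVector, hpt, Matrix.conjTranspose_mul]
        simp only [mul_assoc]
        congr 1
        simpa only [mul_assoc] using Landscape.conjTranspose_mul_cancel (hg τ hV)
          (Landscape.skewBasis e * (W.conjTranspose * Ω))
      have h2 : (Landscape.orbitPoint Γ Ω τ V W).conjTranspose * O *
          Landscape.orbitPoint Γ Ω τ V W = (W.conjTranspose * Ω).conjTranspose *
            Landscape.realDiag (sig ∘ τ) * (W.conjTranspose * Ω) := by
        rw [hpt', ← Landscape.conj_observable τ hΓO hV, Matrix.conjTranspose_mul]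
        simp only [mul_assoc]
      have h3 : ρ = (W.conjTranspose * Ω).conjTranspose *
            Landscape.realDiag lam * (W.conjTranspose * Ω) := by
        have h4 : W * Landscape.realDiag lam * W.conjTranspose = Landscape.realDiag lam := by
          rw [(Landscape.mem_blockUnitary_iff.1 hW).2.eq, mul_assoc,
            Landscape.mul_conjTranspose_self hW.1, mul_one]
        rw [Matrix.conjTranspose_mul, Matrix.conjTranspose_conjTranspose]
        conv_lhs => rw [Landscape.eq_conj_of_conj_eq (D := Landscape.realDiag lam) hΩ hΩρ, ← h4]
        simp only [mul_assoc]
      refine ⟨?_, ?_⟩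
      · rw [h1, h2, Landscape.commute_conj_iff (hh hW), Landscape.skewBasis_commute_iff]
        rfl
      · conv_lhs => rw [h1, h3]
        rw [Landscape.commute_conj_iff (hh hW), Landscape.skewBasis_commute_iff]
    · rw [Landscape.criticalSubmanifold_eq_orbit_at Γ Ω τ hV hW, hpt']
      obtain ⟨b, hb, hA⟩ := Landscape.exists_blockForm sig lam τ (hg τ hV) (hh hW)
      exact ⟨b, fun e => (hb e).trans (hpt τ V W _).symm, hA⟩
  · intro τ
    rw [Landscape.criticalSubmanifold_eq_orbit]
    exact Landscape.isMinimalSubmanifold_orbit _ _ (Landscape.mul_mem_unitarySet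
      (Landscape.conjTranspose_mem_unitarySet hΓ) (Landscape.permMat_mem_unitarySet τ)) hΩ
  · intro hl hs τ
    exact hsame τ fun j k => ((hs.comp τ.injective).eq_iff).trans hl.eq_iff.symm
  · intro i f hi hf hρi hOf
    obtain ⟨z, hz, hlz⟩ := Landscape.eigenvalues_rankOneProj hi hlam hΩ (hρi ▸ hΩρ)
    obtain ⟨z', hz', hsz⟩ := Landscape.eigenvalues_rankOneProj hf hsig hΓ (hOf ▸ hΓO)
    have hzz : z' = z := Fin.ext (hz'.trans hz.symm)
    subst hzz
    -- Both spectra are `(1, 0, …, 0)`, so for the identity permutation the level sets coincide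
    -- trivially.
    have hsl : sig = lam := funext fun j => (hsz j).trans (hlz j).symm
    have hmax : Landscape.maximumSet ρ O = Landscape.criticalSubmanifold sig lam Γ Ω 1 := by
      have h := Landscape.maximumSet_eq hlz hΩ hΓ hΩρ (hsl ▸ hΓO)
      rwa [← hsl] at h ⊢
    refine ⟨hmax, ?_⟩
    rw [hmax]
    exact hsame 1 fun j k => by rw [hsl]; rfl
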